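/- Conventions. For a discrete group $\Gamma$, let $\lambda$ be the left regular representation on $\ell^2(\Gamma)$, $L(\Gamma)=\lambda(\Gamma)''$ the group von Neumann algebra, $\|\cdot\|_\infty$ its (operator) norm, and $\delta_e$ the canonical trace (the Dirac mass at the neutral element $e$). A state on $\Gamma$ is a positive definite function $\varphi:\Gamma\to\mathbb{C}$ with $\varphi(e)=1$. For a function $f$ on $\Gamma$ put $\|f\|=\tfrac12\|f\|_{L(\Gamma)^*}$, half the norm of the normal linear extension of $f$ (that is, of $\lambda(g)\mapsto f(g)$) to $L(\Gamma)$, and $\|f\|=+\infty$ if there is no such extension. For a finite symmetric generating set $S\not\ni e$, let $|g|_S$ be the word length and put $\varphi^+(1)=-\inf_{|g|_S=1}\ln|\varphi(g)|$ (with $\ln 0=-\infty$). Given groups $\Gamma_N$ with states $\varphi_N$ and real sequences $k'(N),k(N)$, the sequence of powers $(\varphi_N^m)_{m\in\mathbb{N}}$ has a pre-cut-off in the window $[k'(N),k(N)]$ if there are constants $B,B',\lambda,\lambda'>0$ such that for every $c>0$ and all $N$ large enough (depending on $c$), $$\|\varphi_N^{m}-\delta_e\|\geq 1-B'e^{-\lambda'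 c}\ \text{ for all integers } 0\le m\leq k'(N)-c,\qquad \|\varphi_N^{m}-\delta_e\|\leq Be^{-\lambda c}\ \text{ for all integers } m\geq k(N)+c .$$ Proposition. Let $(\Lambda_i)_{i\in\mathbb{N}}$ be discrete groups, $T_i\subset\Lambda_i\setminus\{e\}$ a finite symmetric generating set and $\psi_i$ a state on $\Lambda_i$. Assume that there are constants $\alpha,\beta,\delta>0$ such that for all $i$: - $|\psi_i(g)|\leq e^{-\alpha|g|_{T_i}}$ for all $g\in\Lambda_i$ (exponential decay with exponent at least $\alpha$); - $\big\|\sum_{g\in T_i}\lambda(g)\big\|_\infty\leq\delta\sqrt{|T_i|}$; - $\psi_i^+(1)\leq\beta$. Let $\Gamma_N=\Lambda_1*\cdots*\Lambda_N$, let $S_N=T_1\sqcup\cdots\sqcup T_N\subset\Gamma_N$, and let $\varphi_N=\psi_1*\cdots*\psi_N$ be the free product function, $\varphi_N(g_1\cdots g_n)=\prod_j\psi_{i_j}(g_j)$ for a reduced word with $g_j\in\Lambda_{i_j}\setminus\{e\}$, $i_j\neq i_{j+1}$. Then each $\varphi_N$ is a state on $\Gamma_N$ and $(\varphi_N^m)_{m\in\mathbb{N}}$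 has a pre-cut-off in the window $$\left[\frac{\ln\sqrt{|S_N|}}{\beta},\ \frac{\ln\sqrt{|S_N|}}{\alpha}\right]$$ (where $\ln\sqrt{|S_N|}$ is replaced by $0$ if $S_N=\emptyset$). -/

import Mathlib

open scoped ENNReal Pointwise ComplexOrder lp

universe u

noncomputable section

/-! ### States on a discrete group -/

/-- Positive definite functions on a discrete group. The order on `ℂ` is the one for which
`0 ≤ z` means that `z` is a nonnegative real number. -/
def IsPositiveDefinite {Γ : Type u} [Group Γ] (φ : Γ → ℂ) : Prop :=
  ∀ (n : ℕ) (c : Fin n → ℂ) (g : Fin n → Γ),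
    0 ≤ ∑ i, ∑ j, c i * (starRingEnd ℂ) (c j) * φ (g i * (g j)⁻¹)

/-- A state on `ℂ[Γ]`, seen as a normalized positive definite function on `Γ`. -/
structure IsState {Γ : Type u} [Group Γ] (φ : Γ → ℂ) : Prop where
  posDef : IsPositiveDefinite φ
  map_one : φ 1 = 1

open Classical in
/-- The canonical trace `δ_e`: the Dirac mass at the neutral element. -/
def canonicalTrace (Γ : Type u) [Group Γ] : Γ → ℂ := fun g => if g = 1 then 1 else 0

/-! ### The left regular representation and the group von Neumann algebra -/

theorem memlp_leftTranslate {Γ : Type u} [Group Γ] (g : Γ) (f : ℓ²(Γ, ℂ)) :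
    Memℓp (fun h : Γ => f (g⁻¹ * h)) 2 := by
  have h2 : 0 < (2 : ℝ≥0∞).toReal := by norm_num
  refine (memℓp_gen_iff h2).2 ?_
  exact ((memℓp_gen_iff h2).1 (lp.memℓp f)).comp_injective (mul_right_injective g⁻¹)

/-- Left translation by `g` as a linear map on `ℓ²(Γ)`: `(λ_g f)(h) = f(g⁻¹h)`. -/
def leftTranslate {Γ : Type u} [Group Γ] (g : Γ) : ℓ²(Γ, ℂ) →ₗ[ℂ] ℓ²(Γ, ℂ) where
  toFun f := ⟨fun h => f (g⁻¹ * h), memlp_leftTranslate g f⟩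
  map_add' _ _ := rfl
  map_smul' _ _ := rfl

theorem norm_leftTranslate {Γ : Type u} [Group Γ] (g : Γ) (f : ℓ²(Γ, ℂ)) :
    ‖leftTranslate g f‖ = ‖f‖ := by
  have h2 : 0 < (2 : ℝ≥0∞).toReal := by norm_num
  have h : ‖leftTranslate g f‖ ^ (2 : ℝ≥0∞).toReal = ‖f‖ ^ (2 : ℝ≥0∞).toReal := by
    rw [lp.norm_rpow_eq_tsum h2, lp.norm_rpow_eq_tsum h2]
    exact (Equiv.mulLeft g⁻¹).tsum_eq (fun x : Γ => ‖f x‖ ^ (2 : ℝ≥0∞).toReal)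
  exact (Real.rpow_left_inj (norm_nonneg _) (norm_nonneg _) h2.ne').1 h

/-- The left regular representation of `Γ` on `ℓ²(Γ)`. -/
def leftReg {Γ : Type u} [Group Γ] (g : Γ) : ℓ²(Γ, ℂ) →L[ℂ] ℓ²(Γ, ℂ) :=
  (leftTranslate g).mkContinuous 1 (fun f => by rw [one_mul, norm_leftTranslate])

theorem leftReg_apply {Γ : Type u} [Group Γ] (g h : Γ) (f : ℓ²(Γ, ℂ)) :
    leftReg g f h = f (g⁻¹ * h) := rfl

/-- The commutant of the left regular representation. -/
def leftRegCommutant (Γ : Type u) [Group Γ] : VonNeumannAlgebra ℓ²(Γ, ℂ) where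
  toStarSubalgebra := StarSubalgebra.centralizer ℂ (Set.range (leftReg (Γ := Γ)))
  centralizer_centralizer' := by
    change Set.centralizer (Set.centralizer
      (StarSubalgebra.centralizer ℂ (Set.range (leftReg (Γ := Γ))) :
        Set (ℓ²(Γ, ℂ) →L[ℂ] ℓ²(Γ, ℂ)))) =
      (StarSubalgebra.centralizer ℂ (Set.range (leftReg (Γ := Γ))) :
        Set (ℓ²(Γ, ℂ) →L[ℂ] ℓ²(Γ, ℂ)))
    rw [StarSubalgebra.coe_centralizer, Set.centralizer_centralizer_centralizer]

/-- The group von Neumann algebra `L(Γ)`: the bicommutant of the left regular representation. -/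
def groupVN (Γ : Type u) [Group Γ] : VonNeumannAlgebra ℓ²(Γ, ℂ) :=
  (leftRegCommutant Γ).commutant

theorem leftReg_mem_groupVN {Γ : Type u} [Group Γ] (g : Γ) :
    leftReg g ∈ (groupVN Γ).toStarSubalgebra := by
  change leftReg g ∈ groupVN Γ
  rw [groupVN, VonNeumannAlgebra.mem_commutant_iff]
  intro T hT
  have hT' : T ∈ StarSubalgebra.centralizer ℂ (Set.range (leftReg (Γ := Γ))) := hT
  rw [StarSubalgebra.mem_centralizer_iff] at hT'
  exact (hT' _ ⟨g, rfl⟩).1.symm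

/-- The group element `g` as an element of `L(Γ)`. -/
def groupVN.of {Γ : Type u} [Group Γ] (g : Γ) : (groupVN Γ).toStarSubalgebra :=
  ⟨leftReg g, leftReg_mem_groupVN g⟩

/-- Normal (i.e. `σ`-weakly continuous) bounded functionals on `L(Γ)`: those of the form
`T ↦ ∑ₙ ⟨T ξₙ, ηₙ⟩` with `∑ₙ ‖ξₙ‖² < ∞` and `∑ₙ ‖ηₙ‖² < ∞`. -/
def IsNormalFunctional {Γ : Type u} [Group Γ]
    (F : StrongDual ℂ (groupVN Γ).toStarSubalgebra) : Prop :=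
  ∃ ξ η : ℕ → ℓ²(Γ, ℂ), Summable (fun n => ‖ξ n‖ ^ 2) ∧ Summable (fun n => ‖η n‖ ^ 2) ∧
    ∀ T : (groupVN Γ).toStarSubalgebra,
      HasSum (fun n => inner ℂ (η n) ((T : ℓ²(Γ, ℂ) →L[ℂ] ℓ²(Γ, ℂ)) (ξ n))) (F T)

/-- The norm `½‖f‖_{L(Γ)^*}` of a function `f` on `Γ`, extended linearly to `ℂ[Γ]`. It is half
the norm of the normal extension of `f` to `L(Γ)` if there is one (it is then unique, the linear
span of `Γ` being `σ`-weakly dense in `L(Γ)`), and it is infinite otherwise (infimum over the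
empty set). -/
def tvNorm {Γ : Type u} [Group Γ] (f : Γ → ℂ) : ℝ≥0∞ :=
  2⁻¹ * ⨅ (F : StrongDual ℂ (groupVN Γ).toStarSubalgebra)
    (_ : IsNormalFunctional F ∧ ∀ g : Γ, F (groupVN.of g) = f g), ‖F‖ₑ

/-! ### Pre-cut-off -/

/-- The sequence of powers `(φ_N ^ k)_{k ∈ ℕ}` has a pre-cut-off in the window `[k'(N), k(N)]`.
The bounds of the window are real numbers while the number of steps is an integer: the lower
estimate holds for all `m ≤ k'(N) - c`, the upper one for all `m ≥ k(N) + c`. -/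
def HasPreCutOff {Γ : ℕ → Type u} [∀ N, Group (Γ N)] (φ : ∀ N, Γ N → ℂ) (k' k : ℕ → ℝ) : Prop :=
  ∃ B B' l l' : ℝ, 0 < B ∧ 0 < B' ∧ 0 < l ∧ 0 < l' ∧
    ∀ c : ℝ, 0 < c → ∀ᶠ N in Filter.atTop,
      (∀ m : ℕ, (m : ℝ) ≤ k' N - c →
        ENNReal.ofReal (1 - B' * Real.exp (-l' * c)) ≤
          tvNorm (fun g => φ N g ^ m - canonicalTrace (Γ N) g)) ∧
      (∀ m : ℕ, k N + c ≤ (m : ℝ) →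
        tvNorm (fun g => φ N g ^ m - canonicalTrace (Γ N) g) ≤
          ENNReal.ofReal (B * Real.exp (-l * c)))

/-! ### Word length and decay -/

/-- A finite symmetric generating set (not containing the neutral element). -/
structure IsSymmGenSet {Γ : Type u} [Group Γ] (S : Finset Γ) : Prop where
  inv_mem : ∀ g ∈ S, g⁻¹ ∈ S
  closure_eq_top : Subgroup.closure (S : Set Γ) = ⊤
  one_notMem : (1 : Γ) ∉ S

/-- Word length `|g|_S = min {k | g ∈ S ^ k}`. -/
def wordLength {Γ : Type u} [Group Γ] (S : Finset Γ) (g : Γ) : ℕ :=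
  sInf {k : ℕ | g ∈ (S : Set Γ) ^ k}

/-- The sphere of radius `n` for the word length. -/
def wordSphere {Γ : Type u} [Group Γ] (S : Finset Γ) (n : ℕ) : Set Γ :=
  {g | wordLength S g = n}

/-- `φ` decays exponentially with respect to `S` with exponent at least `a`. -/
def HasExpDecay {Γ : Type u} [Group Γ] (S : Finset Γ) (φ : Γ → ℂ) (a : ℝ) : Prop :=
  ∀ g : Γ, ‖φ g‖ ≤ Real.exp (-a * wordLength S g)

/-- `φ⁺(n) = - inf_{g ∈ S(n)} ln |φ(g)|`, with `ln 0 = -∞`. -/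
def phiPlus {Γ : Type u} [Group Γ] (S : Finset Γ) (φ : Γ → ℂ) (n : ℕ) : EReal :=
  -(⨅ g ∈ wordSphere S n, ENNReal.log ‖φ g‖ₑ)

/-! ### Free products -/

open Classical in
/-- The free product of functions `ψ_i` with `ψ_i(e) = 1`: its value at an element with reduced
word `g_1 ⋯ g_n`, `g_j ∈ Λ_{i_j} \ {e}`, `i_j ≠ i_{j+1}`, is `ψ_{i_1}(g_1) ⋯ ψ_{i_n}(g_n)`. -/
def freeProductFun {ι : Type} {Λ : ι → Type u} [∀ i, Group (Λ i)] (ψ : ∀ i, Λ i → ℂ) :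
    Monoid.CoprodI Λ → ℂ :=
  fun g => ((Monoid.CoprodI.Word.equiv g).toList.map (fun p => ψ p.1 p.2)).prod

open Classical in
/-- The union of the sets `T_i` inside the free product of the groups `Λ_i`. -/
def freeProductGen {ι : Type} [Fintype ι] {Λ : ι → Type u} [∀ i, Group (Λ i)]
    (T : ∀ i, Finset (Λ i)) : Finset (Monoid.CoprodI Λ) :=
  Finset.univ.biUnion fun i => (T i).image (Monoid.CoprodI.of (i := i))

end

noncomputable section

/-! ### Positive semidefinite kernels -/

section Kernels

variable {X : Type*}

/-! Write S for the union of the T_i and φ for the free product of the ψ_i. All estimates are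
uniform in N.

State: on reduced words the kernel φ(x⁻¹y) − conj φ(x) φ(y) satisfies a recursion that strips first
letters (`freeProductFun_inv_mul`). Each step uses only sums and Schur products of positive kernels,
so the kernel is positive.

Upper bound: half the ℓ² norm of φ^m − δ_e dominates its norm. Concatenating geodesics in the
factors writes each w as a list of generators with |φ(w)| ≤ exp(-α · length), so summing over all
nonempty lists bounds the squared ℓ² norm by a geometric series of ratio |S| exp(-2αm) ≤ exp(-2αc).
When this ratio is close to 1 the series is useless, and the bound 1 for half the difference of two
states is used instead. It requires that a square summable state have norm at most 1 on all of L(Γ),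
hence a density argument (`mem_closure_span_leftReg`).

Lower bound: test against ∑ c_s λ(s) over S, the c_s being phases that make every term of the
pairing nonnegative. The pairing is at least |S| exp(-βm), while the operator norm is at most (δ +
2)√|S| (`norm_sum_smul_leftReg_freeProductGen_le`), by separating pairs (w, sw) according to whether
w and sw start in the factor of s. -/

theorem Matrix.posSemidef_of_finset {K : Matrix X X ℂ}
    (h : ∀ s : Finset X, (K.submatrix ((↑) : s → X) (↑)).PosSemidef) : K.PosSemidef := by
  classical
  refine ⟨?_, fun x ↦ ?_⟩
  · ext a b
    have := (h {a, b}).isHermitian.apply ⟨a, by simp⟩ ⟨b, by simp⟩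
    simpa using this
  · simpa [Finsupp.sum, ← Finset.sum_attach x.support, ← Finset.subtype_mem_eq_attach,
      ← Finsupp.subtypeDomain_apply, ← Finsupp.support_subtypeDomain] using
      (h x.support).2 (x.subtypeDomain (· ∈ x.support))

/-- Rank one kernels are positive semidefinite. -/
theorem Matrix.posSemidef_conj_mul (f : X → ℂ) :
    (Matrix.of fun x y => (starRingEnd ℂ) (f x) * f y).PosSemidef := by
  refine Matrix.posSemidef_of_finset fun s => ?_
  exact Matrix.posSemidef_vecMulVec_star_self (fun x : s => f x)

/-- The Schur complement of a point at which the kernel takes the value one. -/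
theorem Matrix.PosSemidef.sub_mul_of_apply_eq_one {K : Matrix X X ℂ} (hK : K.PosSemidef) (o : X)
    (ho : K o o = 1) : (Matrix.of fun x y => K x y - K x o * K o y).PosSemidef := by
  refine Matrix.posSemidef_of_finset fun s => ?_
  have h := hK.submatrix (Sum.elim ((↑) : s → X) (fun _ : Unit => o))
  have hB : (K.submatrix (fun _ : Unit => o) ((↑) : s → X)) =
      (K.submatrix ((↑) : s → X) (fun _ : Unit => o)).conjTranspose := by
    ext a b
    simpa using (hK.isHermitian.apply o b).symm
  have h1 : K.submatrix (Sum.elim ((↑) : s → X) (fun _ : Unit => o))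
      (Sum.elim ((↑) : s → X) (fun _ : Unit => o)) =
      Matrix.fromBlocks (K.submatrix ((↑) : s → X) (↑))
        (K.submatrix ((↑) : s → X) (fun _ : Unit => o))
        (K.submatrix ((↑) : s → X) (fun _ : Unit => o)).conjTranspose 1 := by
    rw [← hB]
    ext (a | a) (b | b) <;> simp [ho]
  let : Invertible (1 : Matrix Unit Unit ℂ) := invertibleOne
  rw [h1, Matrix.PosDef.fromBlocks₂₂ _ _ Matrix.PosDef.one, ← hB] at h
  have h2 : (Matrix.of fun x y => K x y - K x o * K o y).submatrix ((↑) : s → X) (↑) =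
      K.submatrix ((↑) : s → X) (↑) - K.submatrix ((↑) : s → X) (fun _ : Unit => o) *
        (1 : Matrix Unit Unit ℂ)⁻¹ * K.submatrix (fun _ : Unit => o) ((↑) : s → X) := by
    ext a b
    simp [Matrix.mul_apply]
  rw [h2]
  exact h

/-- The Schur product theorem over the complex numbers. -/
theorem Matrix.PosSemidef.hadamard_complex {A B : Matrix X X ℂ} (hA : A.PosSemidef)
    (hB : B.PosSemidef) : (A.hadamard B).PosSemidef :=
  hA.hadamard hB

end Kernels

/-! ### Positive definite functions -/

section PositiveDefinite

variable {Γ : Type u} [Group Γ]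

/-- Polarization: the quadratic form is real at the coefficients (1), (1, 1) and (i, 1), which gives
the imaginary and the real part of the identity. -/
theorem IsPositiveDefinite.apply_inv {φ : Γ → ℂ} (h : IsPositiveDefinite φ) (g : Γ) :
    φ g⁻¹ = (starRingEnd ℂ) (φ g) := by
  have h0 := h 1 ![1] ![1]
  have h1 := h 2 ![1, 1] ![1, g]
  have h2 := h 2 ![Complex.I, 1] ![1, g]
  simp [Fin.sum_univ_two, Complex.le_def] at h0 h1 h2
  apply Complex.ext <;> simp <;> linarith [h0.2, h1.2, h2.2]

/-- A function on a group is positive definite exactly when the kernel `φ (x⁻¹ y)` is positive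
semidefinite. -/
theorem isPositiveDefinite_iff_posSemidef {φ : Γ → ℂ} :
    IsPositiveDefinite φ ↔ (Matrix.of fun x y : Γ => φ (x⁻¹ * y)).PosSemidef := by
  classical
  constructor
  · intro h
    refine ⟨?_, fun x => ?_⟩
    · ext a b
      simp [← h.apply_inv]
    -- Conjugated coefficients and inverted points pass from φ(g_i g_j⁻¹), with the conjugate on the
    -- second coefficient, to φ(x⁻¹y), with the conjugate on the first.
    · have := h x.support.card (fun i => star (x (x.support.equivFin.symm i)))
        (fun i => ((x.support.equivFin.symm i : Γ))⁻¹)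
      rw [Equiv.sum_comp x.support.equivFin.symm (fun i => ∑ j : Fin x.support.card,
        star (x i) * (starRingEnd ℂ) (star (x (x.support.equivFin.symm j))) *
        φ ((i : Γ)⁻¹ * ((x.support.equivFin.symm j : Γ)⁻¹)⁻¹))] at this
      simp_rw [fun i : x.support => Equiv.sum_comp x.support.equivFin.symm (fun j : x.support =>
        star (x i) * (starRingEnd ℂ) (star (x j)) * φ ((i : Γ)⁻¹ * ((j : Γ)⁻¹)⁻¹))] at this
      rw [Finset.sum_coe_sort x.support (fun i : Γ => ∑ j : x.support,
        star (x i) * (starRingEnd ℂ) (star (x j)) * φ ((i : Γ)⁻¹ * ((j : Γ)⁻¹)⁻¹))] at this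
      simp_rw [fun i : Γ => Finset.sum_coe_sort x.support (fun j : Γ =>
        star (x i) * (starRingEnd ℂ) (star (x j)) * φ ((i : Γ)⁻¹ * ((j : Γ)⁻¹)⁻¹))] at this
      simp only [Finsupp.sum]
      refine this.trans_eq (Finset.sum_congr rfl fun i _ => Finset.sum_congr rfl fun j _ => ?_)
      simp
      ring
  · intro h n c g
    have h1 := (h.submatrix (fun i : Fin n => (g i)⁻¹)).dotProduct_mulVec_nonneg (star c)
    convert h1 using 1
    simp only [dotProduct, Matrix.mulVec, Finset.mul_sum]
    refine Finset.sum_congr rfl fun i _ => Finset.sum_congr rfl fun j _ => ?_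
    simp
    ring

theorem IsPositiveDefinite.pow {φ : Γ → ℂ} (h : IsPositiveDefinite φ) (m : ℕ) :
    IsPositiveDefinite (fun g => φ g ^ m) := by
  rw [isPositiveDefinite_iff_posSemidef] at h ⊢
  induction m with
  | zero => simpa using Matrix.posSemidef_conj_mul (fun _ : Γ => (1 : ℂ))
  | succ m ih =>
    have e : (Matrix.of fun x y : Γ => φ (x⁻¹ * y) ^ (m + 1)) =
        (Matrix.of fun x y : Γ => φ (x⁻¹ * y) ^ m).hadamard
          (Matrix.of fun x y : Γ => φ (x⁻¹ * y)) := by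
      ext a b
      simp [pow_succ]
    rw [e]
    exact ih.hadamard_complex h

theorem IsState.pow {φ : Γ → ℂ} (h : IsState φ) (m : ℕ) : IsState (fun g => φ g ^ m) :=
  ⟨h.posDef.pow m, by simp [h.map_one]⟩

/-- The Schur complement kernel `φ (x⁻¹ y) - conj (φ x) φ y` of a state. -/
def IsState.schurKernel (φ : Γ → ℂ) : Matrix Γ Γ ℂ :=
  Matrix.of fun x y => φ (x⁻¹ * y) - (starRingEnd ℂ) (φ x) * φ y

theorem IsState.posSemidef_schurKernel {φ : Γ → ℂ} (h : IsState φ) :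
    (IsState.schurKernel φ).PosSemidef := by
  have := (isPositiveDefinite_iff_posSemidef.1 h.posDef).sub_mul_of_apply_eq_one 1
    (by simp [h.map_one])
  convert this using 1
  ext x y
  simp [IsState.schurKernel, h.posDef.apply_inv]

end PositiveDefinite

/-! ### The free product of states -/

section FreeProduct

open Monoid.CoprodI

variable {ι : Type} {Λ : ι → Type u} [∀ i, Group (Λ i)]

/-- The product of the values of the `ψ i` along a list of letters. -/
def letterProd (ψ : ∀ i, Λ i → ℂ) (l : List (Σ i, Λ i)) : ℂ :=
  (l.map fun p => ψ p.1 p.2).prod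

/-- The element of the free product represented by a list of letters. -/
def listEval (l : List (Σ i, Λ i)) : Monoid.CoprodI Λ :=
  (l.map fun p => of p.2).prod

/-- The list of letters is a reduced word. -/
def IsReducedList (l : List (Σ i, Λ i)) : Prop :=
  (∀ p ∈ l, p.2 ≠ 1) ∧ l.IsChain (fun p q => p.1 ≠ q.1)

/-- The list of letters of the inverse. -/
def invList (l : List (Σ i, Λ i)) : List (Σ i, Λ i) :=
  (l.map fun p => ⟨p.1, p.2⁻¹⟩).reverse

theorem invList_cons (a : Σ i, Λ i) (l : List (Σ i, Λ i)) :
    invList (a :: l) = invList l ++ [⟨a.1, a.2⁻¹⟩] := by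
  simp [invList]

theorem listEval_invList (l : List (Σ i, Λ i)) : listEval (invList l) = (listEval l)⁻¹ := by
  induction l with
  | nil => simp [listEval, invList]
  | cons a l ih =>
    rw [invList_cons]
    simp only [listEval, List.map_append, List.prod_append, List.map_cons, List.prod_cons,
      mul_inv_rev] at ih ⊢
    rw [ih]
    simp

theorem IsReducedList.invList {l : List (Σ i, Λ i)} (h : IsReducedList l) :
    IsReducedList (invList l) := by
  refine ⟨?_, ?_⟩
  · intro p hp
    simp only [_root_.invList, List.mem_reverse, List.mem_map] at hp
    obtain ⟨q, hq, rfl⟩ := hp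
    simpa using h.1 q hq
  · rw [_root_.invList, List.isChain_reverse, List.isChain_map]
    exact h.2.imp fun _ _ hab => hab.symm

theorem IsReducedList.tail {a : Σ i, Λ i} {l : List (Σ i, Λ i)} (h : IsReducedList (a :: l)) :
    IsReducedList l :=
  ⟨fun p hp => h.1 p (List.mem_cons_of_mem _ hp), h.2.tail⟩

theorem letterProd_invList {ψ : ∀ i, Λ i → ℂ} (hψ : ∀ i, IsState (ψ i)) (l : List (Σ i, Λ i)) :
    letterProd ψ (invList l) = (starRingEnd ℂ) (letterProd ψ l) := by
  induction l with
  | nil => simp [letterProd, invList]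
  | cons a l ih =>
    rw [invList_cons]
    simp only [letterProd, List.map_append, List.prod_append, List.map_cons, List.prod_cons,
      map_mul] at ih ⊢
    rw [ih, (hψ a.1).posDef.apply_inv]
    simp [mul_comm]

theorem freeProductFun_listEval (ψ : ∀ i, Λ i → ℂ) {l : List (Σ i, Λ i)} (h : IsReducedList l) :
    freeProductFun ψ (listEval l) = letterProd ψ l := by
  classical
  have : freeProductFun ψ (Word.equiv.symm ⟨l, fun p hp => h.1 p hp, h.2⟩) = letterProd ψ l := by
    unfold freeProductFun
    convert congrArg (fun w : Word Λ => letterProd ψ w.toList) (Equiv.apply_symm_apply Word.equiv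
      (⟨l, fun p hp => h.1 p hp, h.2⟩ : Word Λ)) using 1
    unfold letterProd
    congr!
  exact this

theorem letterProd_append {κ : Type} {M : κ → Type u} (ψ : ∀ i, M i → ℂ)
    (s t : List (Σ i, M i)) :
    letterProd ψ (s ++ t) = letterProd ψ s * letterProd ψ t := by
  simp [letterProd]

theorem listEval_append (s t : List (Σ i, Λ i)) :
    listEval (s ++ t) = listEval s * listEval t := by
  simp [listEval]

theorem IsReducedList.invList_append {s t : List (Σ i, Λ i)} (hs : IsReducedList s)
    (ht : IsReducedList t) (h : ∀ p ∈ s.head?, ∀ q ∈ t.head?, p.1 ≠ q.1) :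
    IsReducedList (_root_.invList s ++ t) := by
  refine ⟨fun p hp => ?_, ?_⟩
  · rcases List.mem_append.1 hp with hp | hp
    exacts [hs.invList.1 p hp, ht.1 p hp]
  · refine hs.invList.2.append ht.2 ?_
    intro p hp q hq
    rw [_root_.invList, List.getLast?_reverse, List.head?_map] at hp
    obtain ⟨r, hr, rfl⟩ := Option.mem_map.1 hp
    exact h r hr q hq

theorem exists_isReducedList_listEval (g : Monoid.CoprodI Λ) :
    ∃ l : List (Σ i, Λ i), IsReducedList l ∧ listEval l = g := by
  classical
  refine ⟨(Word.equiv g).toList, ⟨(Word.equiv g).ne_one, (Word.equiv g).chain_ne⟩, ?_⟩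
  exact Word.equiv.symm_apply_apply g

/-- The first letter of a list, as an element of the product of the groups. -/
def headLetter [DecidableEq ι] : List (Σ i, Λ i) → ∀ i, Λ i
  | [] => 1
  | a :: _ => Pi.mulSingle a.1 a.2

variable [Fintype ι]

open Classical in
/-- The sum of the Schur complement kernels of the `ψ i`, at the first letters of two lists. -/
def headKernel (ψ : ∀ i, Λ i → ℂ) (x y : List (Σ i, Λ i)) : ℂ :=
  ∑ i, IsState.schurKernel (ψ i) (headLetter x i) (headLetter y i)

/-- A Schur complement kernel vanishes as soon as one argument is 1, and `headLetter` is 1 away from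
the index of the first letter. Hence only words starting in the same factor interact. -/
theorem headKernel_nil_left {ψ : ∀ i, Λ i → ℂ} (hψ : ∀ i, IsState (ψ i)) (y : List (Σ i, Λ i)) :
    headKernel ψ [] y = 0 :=
  Finset.sum_eq_zero fun i _ => by simp [IsState.schurKernel, headLetter, (hψ i).map_one]

theorem headKernel_nil_right {ψ : ∀ i, Λ i → ℂ} (hψ : ∀ i, IsState (ψ i)) (y : List (Σ i, Λ i)) :
    headKernel ψ y [] = 0 :=
  Finset.sum_eq_zero fun i _ => by
    simp [IsState.schurKernel, headLetter, (hψ i).map_one, (hψ i).posDef.apply_inv]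

theorem headKernel_of_ne {ψ : ∀ i, Λ i → ℂ} (hψ : ∀ i, IsState (ψ i)) {i j : ι} (hij : i ≠ j)
    (a : Λ i) (b : Λ j) (s t : List (Σ i, Λ i)) :
    headKernel ψ (⟨i, a⟩ :: s) (⟨j, b⟩ :: t) = 0 := by
  classical
  refine Finset.sum_eq_zero fun k _ => ?_
  by_cases hk : k = i
  · subst hk
    simp [IsState.schurKernel, headLetter, Pi.mulSingle_eq_of_ne hij,
      (hψ k).map_one, (hψ k).posDef.apply_inv]
  · simp [IsState.schurKernel, headLetter, Pi.mulSingle_eq_of_ne hk, (hψ k).map_one]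

theorem headKernel_same {ψ : ∀ i, Λ i → ℂ} (hψ : ∀ i, IsState (ψ i)) {i : ι}
    (a b : Λ i) (s t : List (Σ i, Λ i)) :
    headKernel ψ (⟨i, a⟩ :: s) (⟨i, b⟩ :: t) = IsState.schurKernel (ψ i) a b := by
  classical
  rw [headKernel, Finset.sum_eq_single i]
  · simp [headLetter]
  · intro k _ hk
    simp [IsState.schurKernel, headLetter, Pi.mulSingle_eq_of_ne hk, (hψ k).map_one]
  · simp

open Classical in
/-- The kernel `φ (x⁻¹ y) - conj (φ x) φ y` of the free product `φ` of the `ψ i`, by recursion on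
reduced words. -/
def wordKernel (ψ : ∀ i, Λ i → ℂ) : List (Σ i, Λ i) → List (Σ i, Λ i) → ℂ
  | [], _ => 0
  | _ :: _, [] => 0
  | a :: s, b :: t => (starRingEnd ℂ) (letterProd ψ s) * letterProd ψ t *
      headKernel ψ (a :: s) (b :: t) + if a = b then wordKernel ψ s t else 0

-- The form of the recursion without case distinction: a sum of two Schur products of kernels pulled
-- back along the head and the tail, from which positivity can be read.
open Classical in
theorem wordKernel_eq {ψ : ∀ i, Λ i → ℂ} (hψ : ∀ i, IsState (ψ i)) (x y : List (Σ i, Λ i)) :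
    wordKernel ψ x y = (starRingEnd ℂ) (letterProd ψ x.tail) * letterProd ψ y.tail *
      headKernel ψ x y + (if x.head? = y.head? then 1 else 0) * wordKernel ψ x.tail y.tail := by
  cases x <;> cases y <;>
    simp [wordKernel, headKernel_nil_left hψ, headKernel_nil_right hψ]

theorem posSemidef_headKernel {ψ : ∀ i, Λ i → ℂ} (hψ : ∀ i, IsState (ψ i)) :
    (Matrix.of (headKernel ψ)).PosSemidef := by
  classical
  have : Matrix.of (headKernel ψ) = ∑ i, (IsState.schurKernel (ψ i)).submatrix
      (fun x => headLetter x i) (fun x => headLetter x i) := by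
    ext x y
    simp [headKernel, Matrix.sum_apply]
  rw [this]
  exact Matrix.posSemidef_sum _ fun i _ => (hψ i).posSemidef_schurKernel.submatrix _

/-- Tails are shorter, so positivity propagates by induction on the length. The indicator of equal
first letters is positive, being a pullback of the identity matrix. -/
theorem posSemidef_wordKernel_length {ψ : ∀ i, Λ i → ℂ} (hψ : ∀ i, IsState (ψ i)) (n : ℕ) :
    ((Matrix.of (wordKernel ψ)).submatrix ((↑) : {l : List (Σ i, Λ i) // l.length ≤ n} → _)
      (↑)).PosSemidef := by
  classical
  induction n with
  | zero =>
    convert Matrix.PosSemidef.zero using 1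
    ext x y
    have hx := List.eq_nil_of_length_eq_zero (Nat.le_zero.1 x.2)
    simp [hx, wordKernel]
  | succ n ih =>
    have h1 := ((Matrix.posSemidef_conj_mul (fun l : List (Σ i, Λ i) => letterProd ψ l.tail)).hadamard_complex
      (posSemidef_headKernel hψ)).submatrix
        ((↑) : {l : List (Σ i, Λ i) // l.length ≤ n + 1} → _)
    have h2 := ((Matrix.PosSemidef.one (n := Option (Σ i, Λ i)) (R := ℂ)).submatrix
        (fun x : {l : List (Σ i, Λ i) // l.length ≤ n + 1} => x.1.head?)).hadamard_complex
      (ih.submatrix (fun x : {l : List (Σ i, Λ i) // l.length ≤ n + 1} =>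
        ⟨x.1.tail, by rw [List.length_tail]; have := x.2; omega⟩))
    convert h1.add h2 using 1
    ext x y
    simp only [Matrix.submatrix_apply, Matrix.of_apply, Matrix.add_apply, Matrix.hadamard_apply,
      Matrix.one_apply]
    exact wordKernel_eq hψ _ _

theorem posSemidef_wordKernel {ψ : ∀ i, Λ i → ℂ} (hψ : ∀ i, IsState (ψ i)) :
    (Matrix.of (wordKernel ψ)).PosSemidef := by
  refine Matrix.posSemidef_of_finset fun s => ?_
  exact (posSemidef_wordKernel_length hψ (s.sup List.length)).submatrix
    (fun x : s => ⟨x.1, Finset.le_sup (f := List.length) x.2⟩)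

/-- A common first letter cancels in x⁻¹y. Two different first letters a, b of the same factor merge
into a⁻¹b ≠ 1, and letters of different factors do not interact; in both cases the resulting word is
reduced and φ factorizes. -/
theorem freeProductFun_inv_mul {ψ : ∀ i, Λ i → ℂ} (hψ : ∀ i, IsState (ψ i))
    {x y : List (Σ i, Λ i)} (hx : IsReducedList x) (hy : IsReducedList y) :
    freeProductFun ψ ((listEval x)⁻¹ * listEval y) =
      (starRingEnd ℂ) (letterProd ψ x) * letterProd ψ y + wordKernel ψ x y := by
  have key : ∀ {s t : List (Σ i, Λ i)}, IsReducedList s → IsReducedList t →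
      (∀ p ∈ s.head?, ∀ q ∈ t.head?, p.1 ≠ q.1) →
      freeProductFun ψ ((listEval s)⁻¹ * listEval t) =
        (starRingEnd ℂ) (letterProd ψ s) * letterProd ψ t := by
    intro s t hs ht h
    rw [← listEval_invList, ← listEval_append, freeProductFun_listEval ψ (hs.invList_append ht h),
      letterProd_append, letterProd_invList hψ]
  induction x generalizing y with
  | nil => rw [key hx hy (by simp)]; simp [wordKernel]
  | cons p s ih =>
    cases y with
    | nil => rw [key hx hy (by simp)]; simp [wordKernel]
    | cons q t =>
      obtain ⟨i, a⟩ := p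
      obtain ⟨j, b⟩ := q
      by_cases hij : i = j
      · subst hij
        by_cases hab : a = b
        · subst hab
          have h1 : (listEval (⟨i, a⟩ :: s))⁻¹ * listEval (⟨i, a⟩ :: t) =
              (listEval s)⁻¹ * listEval t := by
            simp [listEval, mul_assoc]
          rw [h1, ih hx.tail hy.tail]
          simp only [wordKernel, headKernel_same hψ, if_true]
          simp [IsState.schurKernel, letterProd, (hψ i).map_one]
          ring
        · have h1 : (listEval (⟨i, a⟩ :: s))⁻¹ * listEval (⟨i, b⟩ :: t) =
              (listEval s)⁻¹ * listEval (⟨i, a⁻¹ * b⟩ :: t) := by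
            simp [listEval, mul_assoc]
          have hr : IsReducedList ((⟨i, a⁻¹ * b⟩ : Σ i, Λ i) :: t) := by
            refine ⟨fun p hp => ?_, ?_⟩
            · rcases List.mem_cons.1 hp with rfl | hp
              · simpa [inv_mul_eq_one] using hab
              · exact hy.tail.1 p hp
            · have := hy.2
              rw [List.isChain_cons] at this ⊢
              exact this
          have hc := (List.isChain_cons.1 hx.2).1
          rw [h1, key hx.tail hr (fun p hp q hq => by
            obtain rfl : _ = q := by simpa using hq
            exact (hc p hp).symm)]
          have hne : (⟨i, a⟩ : Σ i, Λ i) ≠ ⟨i, b⟩ := by simpa using hab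
          simp only [wordKernel, headKernel_same hψ, if_neg hne]
          simp [IsState.schurKernel, letterProd]
          ring
      · rw [key hx hy (by simpa using hij)]
        have hne : (⟨i, a⟩ : Σ i, Λ i) ≠ ⟨j, b⟩ := fun h => hij (congrArg Sigma.fst h)
        simp only [wordKernel, headKernel_of_ne hψ hij, if_neg hne]
        ring

/-- The free product of states is a state. -/
theorem isState_freeProductFun {ψ : ∀ i, Λ i → ℂ} (hψ : ∀ i, IsState (ψ i)) :
    IsState (freeProductFun ψ) := by
  refine ⟨?_, ?_⟩
  · rw [isPositiveDefinite_iff_posSemidef]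
    choose l hl hlg using exists_isReducedList_listEval (Λ := Λ)
    convert ((Matrix.posSemidef_conj_mul (letterProd ψ)).add
      (posSemidef_wordKernel hψ)).submatrix l using 1
    ext x y
    have := freeProductFun_inv_mul hψ (hl x) (hl y)
    rw [hlg, hlg] at this
    simpa using this
  · simpa [listEval, letterProd] using freeProductFun_listEval ψ
      (l := ([] : List (Σ i, Λ i))) ⟨by simp, List.isChain_nil⟩

end FreeProduct

/-! ### The left regular representation -/

section LeftRegular

variable {Γ : Type u} [Group Γ]

theorem leftReg_mul (g h : Γ) : leftReg (g * h) = leftReg g * leftReg h := by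
  ext f x
  simp [leftReg_apply, mul_assoc]

theorem inner_leftReg_left (g : Γ) (x y : ℓ²(Γ, ℂ)) :
    inner ℂ (leftReg g x) y = inner ℂ x (leftReg g⁻¹ y) := by
  rw [lp.inner_eq_tsum, lp.inner_eq_tsum, ← (Equiv.mulLeft g).tsum_eq]
  simp [leftReg_apply]

theorem star_leftReg (g : Γ) : star (leftReg g) = leftReg g⁻¹ := by
  refine ((ContinuousLinearMap.eq_adjoint_iff _ _).2 fun x y => ?_).symm
  rw [inner_leftReg_left, inv_inv]

open Classical in
/-- The Dirac mass at the neutral element as a vector of `ℓ²(Γ)`. -/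
def deltaVec (Γ : Type u) [Group Γ] : ℓ²(Γ, ℂ) := lp.single 2 1 1

theorem norm_deltaVec : ‖deltaVec Γ‖ = 1 := by
  classical
  simp [deltaVec, lp.norm_single]

theorem coe_deltaVec : ⇑(deltaVec Γ) = canonicalTrace Γ := by
  classical
  ext g
  simp [deltaVec, canonicalTrace, Pi.single_apply]

theorem inner_leftReg_deltaVec (g : Γ) (η : ℓ²(Γ, ℂ)) :
    inner ℂ η (leftReg g (deltaVec Γ)) = (starRingEnd ℂ) (η g) := by
  classical
  rw [← inv_inv g, ← inner_leftReg_left, deltaVec, lp.inner_single_right]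
  simp [leftReg_apply]

end LeftRegular

/-! ### Density of the group algebra in the group von Neumann algebra -/

section Density

variable {Γ : Type u} [Group Γ]

/-- Two copies of an operator, acting on the Hilbert sum of two copies of the space. -/
def doubleOp {H : Type*} [NormedAddCommGroup H] [InnerProductSpace ℂ H] (A : H →L[ℂ] H) :
    WithLp 2 (H × H) →L[ℂ] WithLp 2 (H × H) :=
  (WithLp.prodContinuousLinearEquiv 2 ℂ H H).symm.toContinuousLinearMap ∘L
    (A.prodMap A) ∘L (WithLp.prodContinuousLinearEquiv 2 ℂ H H).toContinuousLinearMap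

theorem doubleOp_apply {H : Type*} [NormedAddCommGroup H] [InnerProductSpace ℂ H]
    (A : H →L[ℂ] H) (v : WithLp 2 (H × H)) :
    doubleOp A v = WithLp.toLp 2 (A v.fst, A v.snd) := rfl

/-- The orthogonal projection on a closed subspace commutes with every operator that preserves,
along with its formal adjoint, the subspace. -/
theorem starProjection_apply_of_mapsTo {E : Type*} [NormedAddCommGroup E] [InnerProductSpace ℂ E]
    (K : Submodule ℂ E) [K.HasOrthogonalProjection] (D D' : E →L[ℂ] E)
    (hD : ∀ x ∈ K, D x ∈ K) (hD' : ∀ x ∈ K, D' x ∈ K)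
    (hadj : ∀ x y, inner ℂ x (D y) = inner ℂ (D' x) y) (v : E) :
    K.starProjection (D v) = D (K.starProjection v) := by
  refine Submodule.eq_starProjection_of_mem_orthogonal (hD _ (K.starProjection_apply_mem v)) ?_
  rw [← map_sub, Submodule.mem_orthogonal]
  intro u hu
  rw [hadj]
  exact (Submodule.mem_orthogonal _ _).1 (K.sub_starProjection_mem_orthogonal v) _ (hD' u hu)

theorem commute_of_mem_groupVN {T E : ℓ²(Γ, ℂ) →L[ℂ] ℓ²(Γ, ℂ)} (hT : T ∈ groupVN Γ)
    (hE : ∀ g x, leftReg g (E x) = E (leftReg g x)) (x : ℓ²(Γ, ℂ)) : E (T x) = T (E x) := by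
  have hE' : E ∈ leftRegCommutant Γ := by
    change E ∈ StarSubalgebra.centralizer ℂ (Set.range (leftReg (Γ := Γ)))
    rw [StarSubalgebra.mem_centralizer_iff]
    rintro _ ⟨g, rfl⟩
    refine ⟨ContinuousLinearMap.ext fun x => hE g x, ?_⟩
    rw [star_leftReg]
    exact ContinuousLinearMap.ext fun x => hE _ x
  have := (VonNeumannAlgebra.mem_commutant_iff.1 hT) E hE'
  exact DFunLike.congr_fun this x

/-- Von Neumann's bicommutant argument for two vectors at once. The projection onto the closure of
the vectors (aξ, aη) commutes with λ ⊕ λ, so its matrix entries lie in the commutant and T ⊕ T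
preserves that closed subspace. Two vectors are needed because the Cauchy–Schwarz inequality for
states involves both Tη and Tδ_e. -/
theorem mem_closure_span_leftReg {T : ℓ²(Γ, ℂ) →L[ℂ] ℓ²(Γ, ℂ)} (hT : T ∈ groupVN Γ)
    (ξ η : ℓ²(Γ, ℂ)) :
    (T ξ, T η) ∈ closure ((fun a : ℓ²(Γ, ℂ) →L[ℂ] ℓ²(Γ, ℂ) => (a ξ, a η)) ''
      (Submodule.span ℂ (Set.range (leftReg (Γ := Γ))) : Set (ℓ²(Γ, ℂ) →L[ℂ] ℓ²(Γ, ℂ)))) := by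
  set v : WithLp 2 (ℓ²(Γ, ℂ) × ℓ²(Γ, ℂ)) := WithLp.toLp 2 (ξ, η) with hv
  let ev : (ℓ²(Γ, ℂ) →L[ℂ] ℓ²(Γ, ℂ)) →ₗ[ℂ] WithLp 2 (ℓ²(Γ, ℂ) × ℓ²(Γ, ℂ)) :=
    { toFun := fun a => doubleOp a v
      map_add' := fun _ _ => rfl
      map_smul' := fun _ _ => rfl }
  let V := (Submodule.span ℂ (Set.range (leftReg (Γ := Γ)))).map ev
  let K := V.topologicalClosure
  have hVinv : ∀ g : Γ, ∀ x ∈ V, doubleOp (leftReg g) x ∈ V := by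
    rintro g _ ⟨a, ha, rfl⟩
    refine ⟨leftReg g * a, ?_, rfl⟩
    induction ha using Submodule.span_induction with
    | mem x hx =>
      obtain ⟨h, rfl⟩ := hx
      rw [← leftReg_mul]
      exact Submodule.subset_span ⟨_, rfl⟩
    | zero => simp
    | add x y _ _ hx hy => rw [mul_add]; exact add_mem hx hy
    | smul c x _ hx => rw [mul_smul_comm]; exact Submodule.smul_mem _ _ hx
  have hKinv : ∀ g : Γ, ∀ x ∈ K, doubleOp (leftReg g) x ∈ K := fun g x hx =>
    map_mem_closure (doubleOp (leftReg g)).continuous hx (hVinv g)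
  have hcomm : ∀ (g : Γ) x, K.starProjection (doubleOp (leftReg g) x) =
      doubleOp (leftReg g) (K.starProjection x) := by
    intro g x
    refine starProjection_apply_of_mapsTo K _ (doubleOp (leftReg g⁻¹)) (hKinv g) (hKinv g⁻¹) ?_ x
    intro x y
    simp only [doubleOp_apply, WithLp.prod_inner_apply]
    rw [inner_leftReg_left, inner_leftReg_left, inv_inv]
    rfl
  have hvK : v ∈ K := by
    refine V.le_topologicalClosure ⟨leftReg 1, Submodule.subset_span ⟨1, rfl⟩, ?_⟩
    have h1 : ∀ x : ℓ²(Γ, ℂ), leftReg (1 : Γ) x = x := fun x => by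
      ext h; simp [leftReg_apply]
    simp [ev, doubleOp_apply, h1, hv]
  let e := WithLp.prodContinuousLinearEquiv 2 ℂ ℓ²(Γ, ℂ) ℓ²(Γ, ℂ)
  let inc : Fin 2 → (ℓ²(Γ, ℂ) →L[ℂ] WithLp 2 (ℓ²(Γ, ℂ) × ℓ²(Γ, ℂ))) :=
    ![e.symm.toContinuousLinearMap ∘L ContinuousLinearMap.inl ℂ _ _,
      e.symm.toContinuousLinearMap ∘L ContinuousLinearMap.inr ℂ _ _]
  have hinc : ∀ k (A : ℓ²(Γ, ℂ) →L[ℂ] ℓ²(Γ, ℂ)) x, inc k (A x) = doubleOp A (inc k x) := by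
    intro k A x
    fin_cases k
    · change WithLp.toLp 2 (A x, 0) = WithLp.toLp 2 (A x, A 0)
      rw [map_zero]
    · change WithLp.toLp 2 (0, A x) = WithLp.toLp 2 (A 0, A x)
      rw [map_zero]
  -- The matrix entries of the projection commute with every λ(g), hence with T.
  have hfst : ∀ k x, (K.starProjection (inc k (T x))).fst =
      T (K.starProjection (inc k x)).fst := by
    intro k x
    refine commute_of_mem_groupVN (E := ContinuousLinearMap.fst ℂ _ _ ∘L e.toContinuousLinearMap ∘L
      K.starProjection ∘L inc k) hT (fun g x => ?_) x
    change leftReg g (K.starProjection (inc k x)).fst =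
      (K.starProjection (inc k (leftReg g x))).fst
    rw [hinc, hcomm]
    rfl
  have hsnd : ∀ k x, (K.starProjection (inc k (T x))).snd =
      T (K.starProjection (inc k x)).snd := by
    intro k x
    refine commute_of_mem_groupVN (E := ContinuousLinearMap.snd ℂ _ _ ∘L e.toContinuousLinearMap ∘L
      K.starProjection ∘L inc k) hT (fun g x => ?_) x
    change leftReg g (K.starProjection (inc k x)).snd =
      (K.starProjection (inc k (leftReg g x))).snd
    rw [hinc, hcomm]
    rfl
  have hT2 : ∀ k x, K.starProjection (doubleOp T (inc k x)) =
      doubleOp T (K.starProjection (inc k x)) := by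
    intro k x
    rw [← hinc, doubleOp_apply, ← hfst, ← hsnd]
    rfl
  have hvdec : v = inc 0 ξ + inc 1 η := by
    change WithLp.toLp 2 (ξ, η) = WithLp.toLp 2 (ξ + 0, 0 + η)
    simp
  have hTv : doubleOp T v ∈ K := by
    have h1 : doubleOp T v = K.starProjection (doubleOp T v) := by
      conv_lhs => rw [← Submodule.starProjection_eq_self_iff.2 hvK]
      rw [hvdec]
      simp only [map_add, hT2]
    rw [h1]
    exact K.starProjection_apply_mem _
  have himg : Set.MapsTo e V ((fun a : ℓ²(Γ, ℂ) →L[ℂ] ℓ²(Γ, ℂ) => (a ξ, a η)) ''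
      (Submodule.span ℂ (Set.range (leftReg (Γ := Γ))) : Set (ℓ²(Γ, ℂ) →L[ℂ] ℓ²(Γ, ℂ)))) := by
    rintro _ ⟨a, ha, rfl⟩
    exact ⟨a, ha, rfl⟩
  exact map_mem_closure (f := e) e.continuous hTv himg

end Density

/-! ### Normal functionals given by square summable functions -/

section Functionals

variable {Γ : Type u} [Group Γ]

/-- The functional `T ↦ ⟨η, T δ_e⟩` on the group von Neumann algebra. -/
def coeffFunctional (η : ℓ²(Γ, ℂ)) : StrongDual ℂ (groupVN Γ).toStarSubalgebra :=
  LinearMap.mkContinuous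
    { toFun := fun T => inner ℂ η ((T : ℓ²(Γ, ℂ) →L[ℂ] ℓ²(Γ, ℂ)) (deltaVec Γ))
      map_add' := fun _ _ => inner_add_right _ _ _
      map_smul' := fun _ _ => inner_smul_right _ _ _ } ‖η‖ fun T => by
    refine (norm_inner_le_norm _ _).trans (mul_le_mul_of_nonneg_left ?_ (norm_nonneg η))
    refine ((T : ℓ²(Γ, ℂ) →L[ℂ] ℓ²(Γ, ℂ)).le_opNorm _).trans ?_
    rw [norm_deltaVec, mul_one]
    rfl

theorem norm_coeffFunctional_le (η : ℓ²(Γ, ℂ)) : ‖coeffFunctional η‖ ≤ ‖η‖ :=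
  LinearMap.mkContinuous_norm_le _ (norm_nonneg _) _

theorem isNormalFunctional_coeffFunctional (η : ℓ²(Γ, ℂ)) :
    IsNormalFunctional (coeffFunctional η) := by
  refine ⟨fun n => if n = 0 then deltaVec Γ else 0, fun n => if n = 0 then η else 0, ?_, ?_, ?_⟩
  · exact summable_of_ne_finset_zero (s := {0}) fun n hn => by simp_all
  · exact summable_of_ne_finset_zero (s := {0}) fun n hn => by simp_all
  · intro T
    have h := hasSum_single (f := fun n : ℕ => inner ℂ (if n = 0 then η else 0)
      ((T : ℓ²(Γ, ℂ) →L[ℂ] ℓ²(Γ, ℂ)) (if n = 0 then deltaVec Γ else 0))) 0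
      (fun n hn => by simp [hn])
    exact h

theorem coeffFunctional_of (η : ℓ²(Γ, ℂ)) (g : Γ) :
    coeffFunctional η (groupVN.of g) = (starRingEnd ℂ) (η g) :=
  inner_leftReg_deltaVec g η

theorem tvNorm_le_coeffFunctional {f : Γ → ℂ} (hf : Memℓp f 2) :
    tvNorm f ≤ 2⁻¹ * ‖coeffFunctional (star (⟨f, hf⟩ : ℓ²(Γ, ℂ)))‖ₑ := by
  refine mul_le_mul_right (iInf₂_le _ ⟨isNormalFunctional_coeffFunctional _, fun g => ?_⟩) _
  rw [coeffFunctional_of]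
  simp

theorem tvNorm_le_of_memlp {f : Γ → ℂ} (hf : Memℓp f 2) :
    tvNorm f ≤ 2⁻¹ * ‖(⟨f, hf⟩ : ℓ²(Γ, ℂ))‖ₑ := by
  refine (tvNorm_le_coeffFunctional hf).trans (mul_le_mul_right ?_ _)
  rw [enorm_le_iff_norm_le]
  exact (norm_coeffFunctional_le _).trans_eq (norm_star _)

/-- This is |φ(a)|² ≤ φ(a*a) on the group algebra, written with φ(a) = ⟨η, aδ_e⟩ and φ(a*a) = ⟨aη,
aδ_e⟩. It is the positivity of the Schur complement kernel at the coefficients of a. -/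
theorem normSq_inner_le_of_mem_span {φ : Γ → ℂ} (hφ : IsState φ) {η : ℓ²(Γ, ℂ)}
    (hη : ∀ g, (starRingEnd ℂ) (η g) = φ g) {a : ℓ²(Γ, ℂ) →L[ℂ] ℓ²(Γ, ℂ)}
    (ha : a ∈ Submodule.span ℂ (Set.range (leftReg (Γ := Γ)))) :
    ‖inner ℂ η (a (deltaVec Γ))‖ ^ 2 ≤ (inner ℂ (a η) (a (deltaVec Γ)) : ℂ).re := by
  obtain ⟨c, rfl⟩ := Finsupp.mem_span_range_iff_exists_finsupp.1 ha
  have h1 : ∀ g h : Γ, inner ℂ (leftReg g η) (leftReg h (deltaVec Γ)) = φ (g⁻¹ * h) := by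
    intro g h
    rw [inner_leftReg_left, ← hη, ← inner_leftReg_deltaVec, leftReg_mul]
    rfl
  have h2 : ∀ h : Γ, inner ℂ η (leftReg h (deltaVec Γ)) = φ h := fun h => by
    rw [inner_leftReg_deltaVec, hη]
  have h3 := hφ.posSemidef_schurKernel.2 c
  have h4 : (c.sum fun i xi => c.sum fun j xj =>
      star xi * IsState.schurKernel φ i j * xj) =
      inner ℂ ((c.sum fun i a => a • leftReg i) η) ((c.sum fun i a => a • leftReg i) (deltaVec Γ)) -
      (starRingEnd ℂ) (inner ℂ η ((c.sum fun i a => a • leftReg i) (deltaVec Γ))) *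
        inner ℂ η ((c.sum fun i a => a • leftReg i) (deltaVec Γ)) := by
    have h5 : ∀ x : ℓ²(Γ, ℂ), (c.sum fun i a => a • leftReg i) x =
        ∑ i ∈ c.support, c i • leftReg i x := fun x => by
      simp [Finsupp.sum]
    have h6 : inner ℂ η (∑ i ∈ c.support, c i • leftReg i (deltaVec Γ)) =
        ∑ i ∈ c.support, c i * φ i := by
      simp only [inner_sum, inner_smul_right, h2]
    rw [h5, h5, h6, sum_inner, map_sum, Finset.sum_mul_sum, ← Finset.sum_sub_distrib]
    refine Finset.sum_congr rfl fun i _ => ?_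
    rw [inner_sum, ← Finset.sum_sub_distrib]
    refine Finset.sum_congr rfl fun j _ => ?_
    simp only [inner_smul_left, inner_smul_right, h1]
    simp [IsState.schurKernel]
    ring
  rw [h4, Complex.conj_mul', sub_nonneg] at h3
  have := (Complex.le_def.1 h3).1
  rwa [← Complex.ofReal_pow, Complex.ofReal_re] at this

theorem normSq_inner_le_of_mem_closure {H : Type*} [NormedAddCommGroup H] [InnerProductSpace ℂ H]
    {ι : Type*} (η : H) (f g : ι → H) (A : Set ι)
    (hA : ∀ a ∈ A, ‖inner ℂ η (g a)‖ ^ 2 ≤ (inner ℂ (f a) (g a) : ℂ).re) (x y : H)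
    (hp : (x, y) ∈ closure ((fun a => (f a, g a)) '' A)) :
    ‖inner ℂ η y‖ ^ 2 ≤ (inner ℂ x y : ℂ).re := by
  have hcl : IsClosed {p : H × H | ‖inner ℂ η p.2‖ ^ 2 ≤ (inner ℂ p.1 p.2 : ℂ).re} :=
    isClosed_le ((continuous_const.inner continuous_snd).norm.pow 2)
      (Complex.continuous_re.comp (continuous_fst.inner continuous_snd))
  refine closure_minimal ?_ hcl hp
  rintro _ ⟨a, ha, rfl⟩
  exact hA a ha

theorem normSq_inner_le_of_mem_groupVN {φ : Γ → ℂ} (hφ : IsState φ) {η : ℓ²(Γ, ℂ)}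
    (hη : ∀ g, (starRingEnd ℂ) (η g) = φ g) {T : ℓ²(Γ, ℂ) →L[ℂ] ℓ²(Γ, ℂ)}
    (hT : T ∈ groupVN Γ) :
    ‖inner ℂ η (T (deltaVec Γ))‖ ^ 2 ≤ (inner ℂ (T η) (T (deltaVec Γ)) : ℂ).re := by
  have hspan : ∀ a ∈ (Submodule.span ℂ (Set.range (leftReg (Γ := Γ))) :
      Set (ℓ²(Γ, ℂ) →L[ℂ] ℓ²(Γ, ℂ))),
      ‖inner ℂ η (a (deltaVec Γ))‖ ^ 2 ≤ (inner ℂ (a η) (a (deltaVec Γ)) : ℂ).re :=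
    fun a ha => normSq_inner_le_of_mem_span hφ hη ha
  exact normSq_inner_le_of_mem_closure η (fun a : ℓ²(Γ, ℂ) →L[ℂ] ℓ²(Γ, ℂ) => a η)
    (fun a => a (deltaVec Γ)) _ hspan (T η) (T (deltaVec Γ))
    (mem_closure_span_leftReg hT η (deltaVec Γ))

/-- Taking 2^n-th roots removes the constant C. -/
theorem le_of_forall_pow_two_pow_le {x y C : ℝ} (hy : 0 ≤ y)
    (h : ∀ n : ℕ, x ^ 2 ^ n ≤ C * y ^ 2 ^ n) : x ≤ y := by
  by_contra! hxy
  rcases hy.eq_or_lt with rfl | hy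
  · have := h 0
    simp at this
    linarith
  · have h1 : 1 < x / y := (one_lt_div hy).2 hxy
    obtain ⟨n, hn⟩ := pow_unbounded_of_one_lt C h1
    have h2 : (x / y) ^ n ≤ (x / y) ^ 2 ^ n := pow_le_pow_right₀ h1.le Nat.lt_two_pow_self.le
    have h3 := h n
    rw [div_pow, div_pow] at h2
    rw [← div_le_iff₀ (by positivity)] at h3
    rw [div_pow] at hn
    linarith

/-- Iterating |φ(T)|² ≤ |φ(T*T)| with the C*-identity turns the crude bound ‖η‖‖T‖ into |φ(T)|^(2^n)
≤ ‖η‖ ‖T‖^(2^n) for all n. -/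
theorem norm_inner_le_of_isState {φ : Γ → ℂ} (hφ : IsState φ) {η : ℓ²(Γ, ℂ)}
    (hη : ∀ g, (starRingEnd ℂ) (η g) = φ g) {T : ℓ²(Γ, ℂ) →L[ℂ] ℓ²(Γ, ℂ)}
    (hT : T ∈ groupVN Γ) : ‖inner ℂ η (T (deltaVec Γ))‖ ≤ ‖T‖ := by
  refine le_of_forall_pow_two_pow_le (C := ‖η‖) (norm_nonneg _) fun n => ?_
  induction n generalizing T with
  | zero =>
    simp only [pow_zero, pow_one]
    refine (norm_inner_le_norm _ _).trans (mul_le_mul_of_nonneg_left ?_ (norm_nonneg η))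
    simpa [norm_deltaVec] using T.le_opNorm (deltaVec Γ)
  | succ n ih =>
    have h1 : ‖inner ℂ η (T (deltaVec Γ))‖ ^ 2 ≤ ‖inner ℂ η ((star T * T) (deltaVec Γ))‖ := by
      refine (normSq_inner_le_of_mem_groupVN hφ hη hT).trans ((Complex.re_le_norm _).trans_eq ?_)
      rw [ContinuousLinearMap.star_eq_adjoint, mul_apply_eq_comp,
        ContinuousLinearMap.adjoint_inner_right]
    have h2 := ih (mul_mem (star_mem hT) hT)
    have h3 : ‖star T * T‖ = ‖T‖ * ‖T‖ := ContinuousLinearMap.norm_adjoint_comp_self T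
    rw [h3, ← sq, ← pow_mul] at h2
    rw [pow_succ' 2 n, pow_mul]
    exact (pow_le_pow_left₀ (by positivity) h1 _).trans h2

theorem tvNorm_sub_canonicalTrace_le_one {φ : Γ → ℂ} (hφ : IsState φ) (h2 : Memℓp φ 2) :
    tvNorm (fun g => φ g - canonicalTrace Γ g) ≤ 1 := by
  have hd : Memℓp (canonicalTrace Γ) 2 := by
    rw [← coe_deltaVec]; exact lp.memℓp _
  refine (tvNorm_le_coeffFunctional (h2.sub hd)).trans ?_
  have h3 : ‖coeffFunctional (star (⟨φ - canonicalTrace Γ, h2.sub hd⟩ : ℓ²(Γ, ℂ)))‖ ≤ 2 := by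
    have h4 : coeffFunctional (star (⟨φ - canonicalTrace Γ, h2.sub hd⟩ : ℓ²(Γ, ℂ))) =
        coeffFunctional (star (⟨φ, h2⟩ : ℓ²(Γ, ℂ))) -
          coeffFunctional (star (⟨canonicalTrace Γ, hd⟩ : ℓ²(Γ, ℂ))) := by
      have h7 : (⟨φ - canonicalTrace Γ, h2.sub hd⟩ : ℓ²(Γ, ℂ)) = ⟨φ, h2⟩ - ⟨canonicalTrace Γ, hd⟩ :=
        rfl
      rw [h7, star_sub]
      ext T
      exact inner_sub_left (𝕜 := ℂ) (star (⟨φ, h2⟩ : ℓ²(Γ, ℂ)))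
        (star (⟨canonicalTrace Γ, hd⟩ : ℓ²(Γ, ℂ)))
        ((T : ℓ²(Γ, ℂ) →L[ℂ] ℓ²(Γ, ℂ)) (deltaVec Γ))
    have h5 : ‖coeffFunctional (star (⟨φ, h2⟩ : ℓ²(Γ, ℂ)))‖ ≤ 1 := by
      refine ContinuousLinearMap.opNorm_le_bound _ zero_le_one fun T => ?_
      rw [one_mul]
      exact norm_inner_le_of_isState hφ (fun g => by simp) T.2
    have h6 : ‖coeffFunctional (star (⟨canonicalTrace Γ, hd⟩ : ℓ²(Γ, ℂ)))‖ ≤ 1 := by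
      refine (norm_coeffFunctional_le _).trans ?_
      rw [norm_star, ← norm_deltaVec (Γ := Γ)]
      exact le_of_eq (congrArg _ (lp.ext coe_deltaVec.symm))
    rw [h4]
    refine (norm_sub_le _ _).trans ?_
    linarith
  calc _ ≤ 2⁻¹ * ENNReal.ofReal 2 := by
        refine mul_le_mul_right ?_ _
        rw [← ofReal_norm]
        exact ENNReal.ofReal_le_ofReal h3
    _ = 1 := by
        rw [ENNReal.ofReal_ofNat]
        exact ENNReal.inv_mul_cancel (by norm_num) (by norm_num)

end Functionals

/-! ### Square summable functions with values in `[0, ∞]` -/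

section EnnL2

/-- The `ℓ²` norm of a function with values in `[0, ∞]`. -/
def ennL2 {X : Type*} (a : X → ℝ≥0∞) : ℝ≥0∞ := (∑' x, a x ^ 2) ^ (1 / 2 : ℝ)

variable {X : Type*}

theorem ennL2_sq (a : X → ℝ≥0∞) : ennL2 a ^ 2 = ∑' x, a x ^ 2 := by
  rw [ennL2, ← ENNReal.rpow_natCast, ← ENNReal.rpow_mul]
  norm_num

theorem ennL2_le_iff {a : X → ℝ≥0∞} {c : ℝ≥0∞} : ennL2 a ≤ c ↔ ∑' x, a x ^ 2 ≤ c ^ 2 := by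
  rw [← ennL2_sq, ENNReal.pow_le_pow_left_iff (by norm_num)]

theorem tsum_mul_le_ennL2_mul (a b : X → ℝ≥0∞) : ∑' x, a x * b x ≤ ennL2 a * ennL2 b := by
  rw [ENNReal.tsum_eq_iSup_sum]
  refine iSup_le fun s => (ENNReal.inner_le_Lp_mul_Lq s a b
    (Real.HolderConjugate.two_two)).trans ?_
  have h : ∀ c : X → ℝ≥0∞, (∑ i ∈ s, c i ^ (2 : ℝ)) ^ (1 / 2 : ℝ) ≤ ennL2 c := fun c => by
    refine ENNReal.rpow_le_rpow ?_ (by norm_num)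
    refine le_trans (le_of_eq ?_) (ENNReal.sum_le_tsum s)
    simp
  exact mul_le_mul' (h a) (h b)

theorem enorm_lp_two {X : Type*} (x : ℓ²(X, ℂ)) : ‖x‖ₑ = ennL2 fun i => ‖x i‖ₑ := by
  have h := lp.norm_rpow_eq_tsum (p := 2) (by norm_num) x
  have hs : Summable fun i => ‖x i‖ ^ 2 := by
    simpa using (lp.memℓp x).summable (by norm_num)
  have h2 : ‖x‖ ^ 2 = ∑' i, ‖x i‖ ^ 2 := by simpa using h
  have h3 : ‖x‖ₑ ^ 2 = ennL2 (fun i => ‖x i‖ₑ) ^ 2 := by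
    rw [ennL2_sq, ← ofReal_norm, ← ENNReal.ofReal_pow (norm_nonneg _), h2,
      ENNReal.ofReal_tsum_of_nonneg (fun i => by positivity) hs]
    refine tsum_congr fun i => ?_
    rw [← ofReal_norm, ENNReal.ofReal_pow (norm_nonneg _)]
  exact (ENNReal.pow_right_strictMono (n := 2) (by norm_num)).injective h3

/-- The vector of `ℓ²` with given square summable nonnegative coordinates. -/
theorem exists_lp_of_ennL2_ne_top {X : Type*} {a : X → ℝ≥0∞} (ha : ennL2 a ≠ ∞) :
    ∃ x : ℓ²(X, ℂ), ∀ i, x i = ((a i).toReal : ℂ) ∧ ‖x i‖ₑ = a i := by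
  have h1 : ∑' i, a i ^ 2 ≠ ∞ := by rw [← ennL2_sq]; exact ENNReal.pow_ne_top ha
  have h2 : ∀ i, a i ≠ ∞ := fun i h => by
    have := ENNReal.ne_top_of_tsum_ne_top h1 i
    simp [h] at this
  have h3 : Memℓp (fun i => ((a i).toReal : ℂ)) 2 := by
    rw [memℓp_gen_iff (by norm_num)]
    have := ENNReal.summable_toReal h1
    simpa using this
  refine ⟨⟨_, h3⟩, fun i => ⟨rfl, ?_⟩⟩
  change ‖((a i).toReal : ℂ)‖ₑ = a i
  rw [← ofReal_norm, Complex.norm_real, Real.norm_of_nonneg ENNReal.toReal_nonneg,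
    ENNReal.ofReal_toReal (h2 i)]

end EnnL2

/-! ### Bilinear forms of convolution operators -/

section Convolution

variable {Γ : Type u} [Group Γ]

/-- For nonnegative vectors the left side is exactly a matrix coefficient of the sum of the λ(g).
Values in [0, ∞] let later sums be exchanged freely. -/
theorem tsum_mul_le_norm_sum_leftReg (T : Finset Γ) {a b : Γ → ℝ≥0∞} (ha : ennL2 a ≠ ∞)
    (hb : ennL2 b ≠ ∞) : ∑' g : T, ∑' h, a h * b (g * h) ≤
      ‖∑ g ∈ T, leftReg g‖ₑ * (ennL2 a * ennL2 b) := by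
  obtain ⟨x, hx⟩ := exists_lp_of_ennL2_ne_top ha
  obtain ⟨y, hy⟩ := exists_lp_of_ennL2_ne_top hb
  have hn : ∀ g h : Γ, 0 ≤ (b (g * h)).toReal * (a h).toReal := fun g h => by positivity
  have h1 : ∀ g : Γ, HasSum (fun h => (b (g * h)).toReal * (a h).toReal)
      (inner ℂ y (leftReg g x) : ℂ).re := by
    intro g
    have h := Complex.hasSum_re
      ((Equiv.mulLeft g).hasSum_iff.2 (lp.hasSum_inner (𝕜 := ℂ) y (leftReg g x)))
    have e : (fun h => (b (g * h)).toReal * (a h).toReal) =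
        fun h => (inner ℂ (y (g * h)) (leftReg g x (g * h))).re := by
      funext h
      rw [leftReg_apply, inv_mul_cancel_left, (hy _).1, (hx _).1]
      simp [mul_comm]
    rw [e]
    exact h
  have h2 : ∑' g : T, ∑' h, a h * b (g * h) =
      ENNReal.ofReal (inner ℂ y ((∑ g ∈ T, leftReg g) x) : ℂ).re := by
    have e : (inner ℂ y ((∑ g ∈ T, leftReg g) x) : ℂ).re =
        ∑ g ∈ T, (inner ℂ y (leftReg g x) : ℂ).re := by
      have : (∑ g ∈ T, leftReg g) x = ∑ g ∈ T, leftReg g x := by simp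
      rw [this, inner_sum, Complex.re_sum]
    rw [e, ENNReal.ofReal_sum_of_nonneg fun g _ => (h1 g).nonneg (hn g), tsum_fintype,
      Finset.sum_coe_sort T (fun g => ∑' h, a h * b (g * h))]
    refine Finset.sum_congr rfl fun g _ => ?_
    rw [← (h1 g).tsum_eq, ENNReal.ofReal_tsum_of_nonneg (hn g) (h1 g).summable]
    refine tsum_congr fun h => ?_
    rw [ENNReal.ofReal_mul ENNReal.toReal_nonneg, mul_comm]
    have hxa := (hx h).2
    have hyb := (hy (g * h)).2
    rw [(hx h).1, ← ofReal_norm, Complex.norm_real, Real.norm_of_nonneg ENNReal.toReal_nonneg]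
      at hxa
    rw [(hy _).1, ← ofReal_norm, Complex.norm_real, Real.norm_of_nonneg ENNReal.toReal_nonneg]
      at hyb
    rw [hxa, hyb]
  rw [h2]
  have h3 : (inner ℂ y ((∑ g ∈ T, leftReg g) x) : ℂ).re ≤ ‖∑ g ∈ T, leftReg g‖ * (‖x‖ * ‖y‖) := by
    refine (Complex.re_le_norm _).trans ((norm_inner_le_norm _ _).trans ?_)
    have := (∑ g ∈ T, leftReg g).le_opNorm x
    nlinarith [norm_nonneg y]
  refine (ENNReal.ofReal_le_ofReal h3).trans (le_of_eq ?_)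
  rw [ENNReal.ofReal_mul (norm_nonneg _), ENNReal.ofReal_mul (norm_nonneg _)]
  simp only [ofReal_norm, enorm_lp_two x, enorm_lp_two y, fun i => (hx i).2, fun i => (hy i).2]

/-- The triangle inequality discards the coefficients, so arbitrary phases cost nothing once the
nonnegative form on the right is bounded. -/
theorem enorm_inner_sum_smul_leftReg_le (S : Finset Γ) (c : Γ → ℂ) (hc : ∀ g, ‖c g‖ ≤ 1)
    (x y : ℓ²(Γ, ℂ)) : ‖inner ℂ y ((∑ g ∈ S, c g • leftReg g) x)‖ₑ ≤
      ∑ g ∈ S, ∑' h, ‖x h‖ₑ * ‖y (g * h)‖ₑ := by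
  have h1 : inner ℂ y ((∑ g ∈ S, c g • leftReg g) x) =
      ∑ g ∈ S, c g * inner ℂ y (leftReg g x) := by
    have : (∑ g ∈ S, c g • leftReg g) x = ∑ g ∈ S, c g • leftReg g x := by simp
    rw [this, inner_sum]
    simp only [inner_smul_right]
  rw [h1]
  refine (enorm_sum_le _ _).trans (Finset.sum_le_sum fun g _ => ?_)
  have h2 : inner ℂ y (leftReg g x) = ∑' h, inner ℂ (y (g * h)) (x h) := by
    rw [lp.inner_eq_tsum, ← (Equiv.mulLeft g).tsum_eq]
    simp [leftReg_apply]
  rw [enorm_mul, h2]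
  have hcg : ‖c g‖ₑ ≤ 1 := by
    rw [← ofReal_norm, ← ENNReal.ofReal_one]
    exact ENNReal.ofReal_le_ofReal (hc g)
  refine (mul_le_of_le_one_left' hcg).trans (enorm_tsum_le_tsum_enorm.trans ?_)
  refine ENNReal.tsum_le_tsum fun h => ?_
  rw [RCLike.inner_apply, enorm_mul]
  simp

end Convolution

/-! ### Splitting off the first letter in a free product -/

section HeadTail

open Monoid.CoprodI

variable {ι : Type} {Λ : ι → Type u} [∀ i, Group (Λ i)]

open Classical in
/-- An element of the free product is a product of an element of `Λ i` and of a reduced word that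
does not start with a letter from `Λ i`. -/
def headTailEquiv (Λ : ι → Type u) [∀ i, Group (Λ i)] (i : ι) :
    Λ i × {r : Word Λ // r.fstIdx ≠ some i} ≃ Monoid.CoprodI Λ :=
  { toFun := fun p => (⟨p.1, p.2.1, p.2.2⟩ : Word.Pair Λ i)
    invFun := fun p => (p.head, ⟨p.tail, p.fstIdx_ne⟩)
    left_inv := fun _ => rfl
    right_inv := fun _ => rfl : Λ i × {r : Word Λ // r.fstIdx ≠ some i} ≃ Word.Pair Λ i }.trans
  ((Word.equivPair i).symm.trans Word.equiv.symm)

theorem headTailEquiv_apply (i : ι) (h : Λ i) (r : {r : Word Λ // r.fstIdx ≠ some i}) :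
    headTailEquiv Λ i (h, r) = of h * r.1.prod := by
  classical
  exact Word.prod_rcons _

theorem of_mul_headTailEquiv (i : ι) (g h : Λ i) (r : {r : Word Λ // r.fstIdx ≠ some i}) :
    of g * headTailEquiv Λ i (h, r) = headTailEquiv Λ i (g * h, r) := by
  rw [headTailEquiv_apply, headTailEquiv_apply, map_mul, mul_assoc]

/-- The component in `Λ i` at the beginning of an element of the free product. -/
def headIn (i : ι) (w : Monoid.CoprodI Λ) : Λ i := ((headTailEquiv Λ i).symm w).1

theorem headIn_headTailEquiv (i : ι) (p : Λ i × {r : Word Λ // r.fstIdx ≠ some i}) :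
    headIn i (headTailEquiv Λ i p) = p.1 := by
  simp [headIn]

theorem headIn_of_mul (i : ι) (g : Λ i) (w : Monoid.CoprodI Λ) :
    headIn i (of g * w) = g * headIn i w := by
  obtain ⟨⟨h, r⟩, rfl⟩ := (headTailEquiv Λ i).surjective w
  rw [of_mul_headTailEquiv, headIn_headTailEquiv, headIn_headTailEquiv]

theorem headIn_of (i : ι) (g : Λ i) : headIn i (of g) = g := by
  have h := headTailEquiv_apply i g ⟨Word.empty, by simp [Word.fstIdx]⟩
  rw [Word.prod_empty, mul_one] at h
  rw [← h, headIn_headTailEquiv]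

theorem eq_of_headIn_ne_one {i j : ι} {w : Monoid.CoprodI Λ} (hi : headIn i w ≠ 1)
    (hj : headIn j w ≠ 1) : i = j := by
  classical
  have key : ∀ k, headIn k w ≠ 1 → (Word.equiv w).fstIdx = some k := by
    intro k hk
    obtain ⟨⟨h, r⟩, rfl⟩ := (headTailEquiv Λ k).surjective w
    rw [headIn_headTailEquiv] at hk
    have : Word.equiv (headTailEquiv Λ k (h, r)) = Word.rcons ⟨h, r.1, r.2⟩ :=
      Word.equiv.apply_symm_apply _
    rw [this, Word.rcons, dif_neg hk, Word.fstIdx_cons]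
  have := (key i hi).symm.trans (key j hj)
  simpa using this

end HeadTail

/-! ### The norm of a sum of generators of a free product -/

section Voiculescu

open Monoid.CoprodI

variable {ι : Type} {Λ : ι → Type u} [∀ i, Group (Λ i)]

theorem ENNReal.tsum_prod_apply {X Y : Type*} (f : X × Y → ℝ≥0∞) :
    ∑' p, f p = ∑' x, ∑' y, f (x, y) :=
  ENNReal.tsum_prod (f := fun x y => f (x, y))

/-- The operator norm of an element of `ℂ[Λ i]` does not increase in the free product. -/
theorem tsum_of_mul_le (i : ι) (T : Finset (Λ i)) {a b : Monoid.CoprodI Λ → ℝ≥0∞}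
    (ha : ennL2 a ≠ ∞) (hb : ennL2 b ≠ ∞) : ∑' g : T, ∑' w, a w * b (of (g : Λ i) * w) ≤
      ‖∑ g ∈ T, leftReg g‖ₑ * (ennL2 a * ennL2 b) := by
  -- Under left multiplication by Λ i, the free product is a disjoint union of copies of Λ i indexed
  -- by r. The bound holds on each copy, and Cauchy–Schwarz over r reassembles them.
  have hs : ∀ c : Monoid.CoprodI Λ → ℝ≥0∞,
      ∑' r, ennL2 (fun h => c (headTailEquiv Λ i (h, r))) ^ 2 = ∑' w, c w ^ 2 := fun c => by
    rw [← (headTailEquiv Λ i).tsum_eq, ENNReal.tsum_prod_apply, ENNReal.tsum_comm]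
    exact tsum_congr fun r => ennL2_sq _
  have hL : ∀ c : Monoid.CoprodI Λ → ℝ≥0∞,
      ennL2 (fun r => ennL2 (fun h => c (headTailEquiv Λ i (h, r)))) = ennL2 c := fun c => by
    rw [ennL2, hs c, ennL2]
  have hfin : ∀ c : Monoid.CoprodI Λ → ℝ≥0∞, ennL2 c ≠ ∞ → ∀ r,
      ennL2 (fun h => c (headTailEquiv Λ i (h, r))) ≠ ∞ := by
    intro c hc r h
    have h1 : ∑' w, c w ^ 2 ≠ ∞ := by rw [← ennL2_sq]; exact ENNReal.pow_ne_top hc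
    rw [← hs c] at h1
    have := ENNReal.ne_top_of_tsum_ne_top h1 r
    simp [h] at this
  calc ∑' g : T, ∑' w, a w * b (of (g : Λ i) * w)
      = ∑' r, ∑' g : T, ∑' h, a (headTailEquiv Λ i (h, r)) *
          b (headTailEquiv Λ i ((g : Λ i) * h, r)) := by
        rw [ENNReal.tsum_comm (α := {r : Word Λ // r.fstIdx ≠ some i})]
        refine tsum_congr fun g => ?_
        rw [← (headTailEquiv Λ i).tsum_eq, ENNReal.tsum_prod_apply, ENNReal.tsum_comm]
        simp only [of_mul_headTailEquiv]
    _ ≤ ∑' r, ‖∑ g ∈ T, leftReg g‖ₑ * (ennL2 (fun h => a (headTailEquiv Λ i (h, r))) *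
          ennL2 (fun h => b (headTailEquiv Λ i (h, r)))) :=
        ENNReal.tsum_le_tsum fun r => tsum_mul_le_norm_sum_leftReg T (hfin a ha r) (hfin b hb r)
    _ ≤ _ := by
        rw [ENNReal.tsum_mul_left, ← hL a, ← hL b]
        exact mul_le_mul_right (tsum_mul_le_ennL2_mul _ _) _

open Classical in
/-- The restriction of a function to the elements that start with a letter from `Λ i`. -/
def restrictHead (i : ι) (a : Monoid.CoprodI Λ → ℝ≥0∞) (w : Monoid.CoprodI Λ) : ℝ≥0∞ :=
  if headIn i w = 1 then 0 else a w

open Classical in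
/-- The restriction of a function to the elements that do not start with a letter from `Λ i`. -/
def restrictNoHead (i : ι) (a : Monoid.CoprodI Λ → ℝ≥0∞) (w : Monoid.CoprodI Λ) : ℝ≥0∞ :=
  if headIn i w = 1 then a w else 0

theorem restrictHead_le (i : ι) (a : Monoid.CoprodI Λ → ℝ≥0∞) (w : Monoid.CoprodI Λ) :
    restrictHead i a w ≤ a w := by
  unfold restrictHead; split_ifs <;> simp

theorem restrictNoHead_le (i : ι) (a : Monoid.CoprodI Λ → ℝ≥0∞) (w : Monoid.CoprodI Λ) :
    restrictNoHead i a w ≤ a w := by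
  unfold restrictNoHead; split_ifs <;> simp

theorem ennL2_mono {X : Type*} {a b : X → ℝ≥0∞} (h : ∀ x, a x ≤ b x) : ennL2 a ≤ ennL2 b :=
  ENNReal.rpow_le_rpow (ENNReal.tsum_le_tsum fun x => pow_le_pow_left' (h x) 2) (by norm_num)

/-- A word starts in at most one factor, so the restrictions have disjoint supports. -/
theorem tsum_ennL2_restrictHead_sq_le (a : Monoid.CoprodI Λ → ℝ≥0∞) :
    ∑' i, ennL2 (restrictHead i a) ^ 2 ≤ ennL2 a ^ 2 := by
  simp only [ennL2_sq]
  rw [ENNReal.tsum_comm]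
  refine ENNReal.tsum_le_tsum fun w => ?_
  by_cases h : ∃ i, headIn i w ≠ 1
  · obtain ⟨i, hi⟩ := h
    rw [tsum_eq_single i]
    · exact pow_le_pow_left' (restrictHead_le i a w) 2
    · intro j hj
      have : headIn j w = 1 := by
        by_contra hj'
        exact hj (eq_of_headIn_ne_one hj' hi)
      simp [restrictHead, this]
  · push Not at h
    simp [restrictHead, h]

/-- Words that start in `Λ i` and are sent by a generator to words that start in `Λ i`. -/
theorem tsum_restrictHead_restrictHead_le (T : ∀ i, Finset (Λ i)) {C : ℝ≥0∞}
    (hC : ∀ i, ‖∑ g ∈ T i, leftReg g‖ₑ ≤ C) {a b : Monoid.CoprodI Λ → ℝ≥0∞}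
    (ha : ennL2 a ≠ ∞) (hb : ennL2 b ≠ ∞) :
    ∑' i, ∑' g : T i, ∑' w, restrictHead i a w * restrictHead i b (of (g : Λ i) * w) ≤
      C * (ennL2 a * ennL2 b) := by
  have hfin : ∀ c : Monoid.CoprodI Λ → ℝ≥0∞, ennL2 c ≠ ∞ → ∀ i, ennL2 (restrictHead i c) ≠ ∞ :=
    fun c hc i => ne_top_of_le_ne_top hc (ennL2_mono (restrictHead_le i c))
  have hle : ∀ c : Monoid.CoprodI Λ → ℝ≥0∞, ennL2 (fun i => ennL2 (restrictHead i c)) ≤ ennL2 c :=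
    fun c => ennL2_le_iff.2 (tsum_ennL2_restrictHead_sq_le c)
  calc _ ≤ ∑' i, C * (ennL2 (restrictHead i a) * ennL2 (restrictHead i b)) :=
        ENNReal.tsum_le_tsum fun i => (tsum_of_mul_le i (T i) (hfin a ha i) (hfin b hb i)).trans
          (mul_le_mul_left (hC i) _)
    _ ≤ _ := by
        rw [ENNReal.tsum_mul_left]
        exact mul_le_mul_right ((tsum_mul_le_ennL2_mul _ _).trans (mul_le_mul' (hle a) (hle b))) _

variable [Fintype ι]

/-- Words that do not start in `Λ i` and are sent by a generator to words that start in `Λ i`. -/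
theorem tsum_restrictNoHead_mul_le (T : ∀ i, Finset (Λ i)) (hT : ∀ i, (1 : Λ i) ∉ T i)
    (a b : Monoid.CoprodI Λ → ℝ≥0∞) :
    ∑' i, ∑' g : T i, ∑' w, restrictNoHead i a w * b (of (g : Λ i) * w) ≤
      (∑ i, ((T i).card : ℝ≥0∞)) ^ (1 / 2 : ℝ) * (ennL2 a * ennL2 b) := by
  classical
  let J := (Σ i, T i) × Monoid.CoprodI Λ
  let A : J → ℝ≥0∞ := fun p => restrictNoHead p.1.1 a p.2
  let B : J → ℝ≥0∞ := fun p => if headIn p.1.1 p.2 = 1 then b (of (p.1.2 : Λ p.1.1) * p.2) else 0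
  have h0 : ∑' i, ∑' g : T i, ∑' w, restrictNoHead i a w * b (of (g : Λ i) * w) =
      ∑' p : J, A p * B p := by
    rw [ENNReal.tsum_prod_apply, ENNReal.tsum_sigma']
    refine tsum_congr fun i => tsum_congr fun g => tsum_congr fun w => ?_
    simp only [A, B, restrictNoHead]
    split_ifs <;> simp
  -- Each w is counted at most once per generator, whence the factor √|S|.
  have hA : ennL2 A ≤ (∑ i, ((T i).card : ℝ≥0∞)) ^ (1 / 2 : ℝ) * ennL2 a := by
    rw [ennL2, ennL2, ← ENNReal.mul_rpow_of_nonneg _ _ (by norm_num)]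
    refine ENNReal.rpow_le_rpow ?_ (by norm_num)
    rw [ENNReal.tsum_prod_apply, ENNReal.tsum_sigma', tsum_fintype, Finset.sum_mul]
    refine Finset.sum_le_sum fun i _ => ?_
    calc _ ≤ ∑' _ : T i, ∑' w, a w ^ 2 := ENNReal.tsum_le_tsum fun g =>
          ENNReal.tsum_le_tsum fun w => pow_le_pow_left' (restrictNoHead_le i a w) 2
      _ = _ := by simp
  have hB : ennL2 B ≤ ennL2 b := by
    rw [ennL2_le_iff, ENNReal.tsum_prod_apply, ENNReal.tsum_sigma']
    refine le_trans (ENNReal.tsum_le_tsum fun i => ?_) (tsum_ennL2_restrictHead_sq_le b)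
    rw [ennL2_sq, ← ENNReal.tsum_prod_apply
      (fun p : T i × Monoid.CoprodI Λ => B (⟨i, p.1⟩, p.2) ^ 2)]
    -- When w does not start in Λ i, the head of gw is g, so gw determines g and w.
    have hinj : Function.Injective fun p : {p : T i × Monoid.CoprodI Λ // headIn i p.2 = 1} =>
        of (p.1.1 : Λ i) * p.1.2 := by
      rintro ⟨⟨g, w⟩, hw⟩ ⟨⟨g', w'⟩, hw'⟩ h
      have h1 := congrArg (headIn i) h
      simp only [headIn_of_mul] at hw hw' h1
      rw [hw, hw', mul_one, mul_one] at h1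
      have h2 : g = g' := Subtype.ext h1
      subst h2
      simpa using h
    calc ∑' p : T i × Monoid.CoprodI Λ, B (⟨i, p.1⟩, p.2) ^ 2
        = ∑' p : {p : T i × Monoid.CoprodI Λ // headIn i p.2 = 1},
            restrictHead i b (of (p.1.1 : Λ i) * p.1.2) ^ 2 := by
          refine Eq.trans ?_ (tsum_subtype {p : T i × Monoid.CoprodI Λ | headIn i p.2 = 1}
            (fun p => restrictHead i b (of (p.1 : Λ i) * p.2) ^ 2)).symm
          refine tsum_congr fun p => ?_
          by_cases hp : headIn i p.2 = 1
          · have : (p.1 : Λ i) ≠ 1 := fun h => hT i (h ▸ p.1.2)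
            simp [B, hp, Set.indicator, restrictHead, headIn_of_mul, this]
          · simp [B, hp, Set.indicator]
      _ ≤ _ := ENNReal.tsum_comp_le_tsum_of_injective hinj (fun w => restrictHead i b w ^ 2)
  rw [h0]
  refine (tsum_mul_le_ennL2_mul A B).trans ?_
  rw [← mul_assoc]
  exact mul_le_mul' hA hB

/-- If w and gw both start in Λ i, orthogonality of the restrictions leaves the single constant C.
If one of them does not, Cauchy–Schwarz gives the square root of the number of generators; the two
such cases are exchanged by g ↦ g⁻¹. -/
theorem tsum_generators_le (T : ∀ i, Finset (Λ i)) (hT : ∀ i, IsSymmGenSet (T i)) {C : ℝ≥0∞}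
    (hC : ∀ i, ‖∑ g ∈ T i, leftReg g‖ₑ ≤ C) {a b : Monoid.CoprodI Λ → ℝ≥0∞}
    (ha : ennL2 a ≠ ∞) (hb : ennL2 b ≠ ∞) :
    ∑' i, ∑' g : T i, ∑' w, a w * b (of (g : Λ i) * w) ≤
      (C + 2 * (∑ i, ((T i).card : ℝ≥0∞)) ^ (1 / 2 : ℝ)) * (ennL2 a * ennL2 b) := by
  have hT1 : ∀ i, (1 : Λ i) ∉ T i := fun i => (hT i).one_notMem
  have hpt : ∀ i, ∀ g : T i, ∀ w, a w * b (of (g : Λ i) * w) ≤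
      restrictHead i a w * restrictHead i b (of (g : Λ i) * w) +
      restrictNoHead i a w * b (of (g : Λ i) * w) +
      a w * restrictNoHead i b (of (g : Λ i) * w) := by
    intro i g w
    have hg : (g : Λ i) ≠ 1 := fun h => hT1 i (h ▸ g.2)
    by_cases h1 : headIn i w = 1
    · simp [restrictHead, restrictNoHead, h1]
    · by_cases h2 : (g : Λ i) * headIn i w = 1
      · simp [restrictHead, restrictNoHead, h1, headIn_of_mul, h2]
      · simp [restrictHead, restrictNoHead, h1, headIn_of_mul, h2]
  have h3 : ∑' i, ∑' g : T i, ∑' w, a w * restrictNoHead i b (of (g : Λ i) * w) =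
      ∑' i, ∑' g : T i, ∑' w, restrictNoHead i b w * a (of (g : Λ i) * w) := by
    refine tsum_congr fun i => ?_
    let e : T i ≃ T i :=
      { toFun := fun g => ⟨(g : Λ i)⁻¹, (hT i).inv_mem _ g.2⟩
        invFun := fun g => ⟨(g : Λ i)⁻¹, (hT i).inv_mem _ g.2⟩
        left_inv := fun g => by simp
        right_inv := fun g => by simp }
    rw [← e.tsum_eq]
    refine tsum_congr fun g => ?_
    rw [← (Equiv.mulLeft (of (g : Λ i))).tsum_eq]
    refine tsum_congr fun w => ?_
    simp [e, mul_comm]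
  calc _ ≤ ∑' i, ∑' g : T i, ∑' w, (restrictHead i a w * restrictHead i b (of (g : Λ i) * w) +
        restrictNoHead i a w * b (of (g : Λ i) * w) +
        a w * restrictNoHead i b (of (g : Λ i) * w)) :=
        ENNReal.tsum_le_tsum fun i => ENNReal.tsum_le_tsum fun g => ENNReal.tsum_le_tsum (hpt i g)
    _ ≤ _ := by
        simp only [ENNReal.tsum_add]
        rw [h3]
        refine (add_le_add (add_le_add (tsum_restrictHead_restrictHead_le T hC ha hb)
          (tsum_restrictNoHead_mul_le T hT1 a b)) (tsum_restrictNoHead_mul_le T hT1 b a)).trans ?_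
        rw [mul_comm (ennL2 b)]
        exact le_of_eq (by ring)

theorem pairwiseDisjoint_image_of [DecidableEq (Monoid.CoprodI Λ)] (T : ∀ i, Finset (Λ i))
    (hT : ∀ i, (1 : Λ i) ∉ T i) : ((Finset.univ : Finset ι) : Set ι).PairwiseDisjoint
      fun i => (T i).image (of (i := i)) := by
  intro i _ j _ hij
  rw [Function.onFun, Finset.disjoint_left]
  intro w hwi hwj
  obtain ⟨g, hg, rfl⟩ := Finset.mem_image.1 hwi
  obtain ⟨h, hh, he⟩ := Finset.mem_image.1 hwj
  refine hij (eq_of_headIn_ne_one (w := of g) ?_ ?_)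
  · rw [headIn_of]; rintro rfl; exact hT _ hg
  · rw [← he, headIn_of]; rintro rfl; exact hT _ hh

theorem sum_freeProductGen {M : Type*} [AddCommMonoid M] (T : ∀ i, Finset (Λ i))
    (hT : ∀ i, (1 : Λ i) ∉ T i) (f : Monoid.CoprodI Λ → M) :
    ∑ s ∈ freeProductGen T, f s = ∑ i, ∑ g ∈ T i, f (of g) := by
  classical
  have h := Finset.sum_biUnion (f := f) (pairwiseDisjoint_image_of T hT)
  have e : freeProductGen T = Finset.univ.biUnion fun i => (T i).image (of (i := i)) := by
    unfold freeProductGen; congr!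
  rw [e, h]
  exact Finset.sum_congr rfl fun i _ => Finset.sum_image fun x _ y _ hxy => of_injective i hxy

theorem card_freeProductGen (T : ∀ i, Finset (Λ i)) (hT : ∀ i, (1 : Λ i) ∉ T i) :
    (freeProductGen T).card = ∑ i, (T i).card := by
  have := sum_freeProductGen T hT (fun _ => 1)
  simpa using this

/-- A sum of generators of a free product, with coefficients in the unit disc, has norm of the order
of the square root of the number of generators. -/
theorem norm_sum_smul_leftReg_freeProductGen_le (T : ∀ i, Finset (Λ i))
    (hT : ∀ i, IsSymmGenSet (T i)) {δ : ℝ} (hδ : 0 < δ)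
    (hnorm : ∀ i, ‖∑ g ∈ T i, leftReg g‖ ≤ δ * Real.sqrt ((T i).card : ℝ))
    (c : Monoid.CoprodI Λ → ℂ) (hc : ∀ g, ‖c g‖ ≤ 1) :
    ‖∑ s ∈ freeProductGen T, c s • leftReg s‖ ≤
      (δ + 2) * Real.sqrt ((freeProductGen T).card : ℝ) := by
  have hT1 : ∀ i, (1 : Λ i) ∉ T i := fun i => (hT i).one_notMem
  set n := (freeProductGen T).card with hn
  have hcard : n = ∑ i, (T i).card := card_freeProductGen T hT1
  have hC : ∀ i, ‖∑ g ∈ T i, leftReg g‖ₑ ≤ ENNReal.ofReal (δ * Real.sqrt n) := by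
    intro i
    rw [← ofReal_norm]
    refine ENNReal.ofReal_le_ofReal ((hnorm i).trans ?_)
    refine mul_le_mul_of_nonneg_left (Real.sqrt_le_sqrt ?_) hδ.le
    rw [hcard]
    exact_mod_cast Finset.single_le_sum (f := fun i => (T i).card) (fun _ _ => Nat.zero_le _)
      (Finset.mem_univ i)
  have hsq : (∑ i, ((T i).card : ℝ≥0∞)) ^ (1 / 2 : ℝ) = ENNReal.ofReal (Real.sqrt n) := by
    rw [Real.sqrt_eq_rpow, ← ENNReal.ofReal_rpow_of_nonneg (Nat.cast_nonneg _) (by norm_num),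
      ENNReal.ofReal_natCast, hcard, Nat.cast_sum]
  have hfin : ∀ x : ℓ²(Monoid.CoprodI Λ, ℂ), ennL2 (fun w => ‖x w‖ₑ) ≠ ∞ := fun x => by
    rw [← enorm_lp_two]; exact enorm_ne_top
  have hinner : ∀ x y : ℓ²(Monoid.CoprodI Λ, ℂ),
      ‖inner ℂ y ((∑ s ∈ freeProductGen T, c s • leftReg s) x)‖ ≤
        (δ + 2) * Real.sqrt n * ‖x‖ * ‖y‖ := by
    intro x y
    have h1 := enorm_inner_sum_smul_leftReg_le (freeProductGen T) c hc x y
    rw [sum_freeProductGen T hT1 (fun s => ∑' w, ‖x w‖ₑ * ‖y (s * w)‖ₑ)] at h1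
    have h2 := tsum_generators_le T hT hC (hfin x) (hfin y)
    have h4 : ∀ i, ∑' g : T i, ∑' w, ‖x w‖ₑ * ‖y (of (g : Λ i) * w)‖ₑ =
        ∑ g ∈ T i, ∑' w, ‖x w‖ₑ * ‖y (of g * w)‖ₑ := fun i => by
      rw [tsum_fintype, Finset.sum_coe_sort (T i) (fun g => ∑' w, ‖x w‖ₑ * ‖y (of g * w)‖ₑ)]
    rw [tsum_fintype, Finset.sum_congr rfl fun i _ => h4 i] at h2
    have h3 := h1.trans h2
    have h5 : 2 * ENNReal.ofReal (Real.sqrt n) = ENNReal.ofReal (2 * Real.sqrt n) := by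
      rw [ENNReal.ofReal_mul (by norm_num), ENNReal.ofReal_ofNat]
    rw [hsq, ← enorm_lp_two, ← enorm_lp_two, ← ofReal_norm, ← ofReal_norm, ← ofReal_norm,
      ← ENNReal.ofReal_mul (norm_nonneg _), h5,
      ← ENNReal.ofReal_add (by positivity) (by positivity),
      ← ENNReal.ofReal_mul (by positivity), ENNReal.ofReal_le_ofReal_iff (by positivity)] at h3
    refine h3.trans (le_of_eq ?_)
    ring
  refine ContinuousLinearMap.opNorm_le_bound _ (by positivity) fun x => ?_
  -- Pairing the image of x with itself turns the bilinear bound into an operator norm bound.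
  set y := (∑ s ∈ freeProductGen T, c s • leftReg s) x with hy
  have h1 := hinner x y
  rw [← hy, inner_self_eq_norm_sq_to_K, norm_pow, RCLike.norm_ofReal, abs_norm, sq] at h1
  rcases (norm_nonneg y).eq_or_lt with h0 | h0
  · rw [← h0]; positivity
  · exact le_of_mul_le_mul_right h1 h0

end Voiculescu

/-! ### Word length -/

section WordLength

variable {Γ : Type u} [Group Γ]

theorem list_prod_mem_pow_length (S : Set Γ) (l : List Γ) (hl : ∀ x ∈ l, x ∈ S) :
    l.prod ∈ S ^ l.length := by
  induction l with
  | nil => simp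
  | cons a l ih =>
    rw [List.prod_cons, List.length_cons, pow_succ']
    exact Set.mul_mem_mul (hl a (by simp)) (ih fun x hx => hl x (by simp [hx]))

theorem IsSymmGenSet.exists_list_length_eq {T : Finset Γ} (hT : IsSymmGenSet T) (g : Γ) :
    ∃ l : List Γ, (∀ x ∈ l, x ∈ T) ∧ l.prod = g ∧ l.length = wordLength T g := by
  -- Without this the infimum could be the default value 0. Symmetry of T makes every element a
  -- product of generators without inverses.
  have hne : {k : ℕ | g ∈ (T : Set Γ) ^ k}.Nonempty := by
    have hg : g ∈ Subgroup.closure (T : Set Γ) := hT.closure_eq_top ▸ Subgroup.mem_top g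
    rw [← Subgroup.mem_toSubmonoid, Subgroup.closure_toSubmonoid] at hg
    obtain ⟨l, hl, rfl⟩ := Submonoid.exists_list_of_mem_closure hg
    refine ⟨l.length, list_prod_mem_pow_length _ l fun x hx => ?_⟩
    rcases hl x hx with h | h
    · exact h
    · have := hT.inv_mem _ h
      rwa [inv_inv] at this
  have hmem : g ∈ (T : Set Γ) ^ wordLength T g := Nat.sInf_mem hne
  obtain ⟨f, hf⟩ := Set.mem_pow.1 hmem
  refine ⟨List.ofFn fun i => (f i : Γ), fun x hx => ?_, hf, by simp⟩
  obtain ⟨i, rfl⟩ := (List.mem_ofFn' _ _).1 hx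
  exact (f i).2

theorem IsSymmGenSet.wordLength_eq_one {T : Finset Γ} (hT : IsSymmGenSet T) {g : Γ} (hg : g ∈ T) :
    wordLength T g = 1 := by
  refine le_antisymm (Nat.sInf_le (by simpa using hg)) ?_
  by_contra! h
  obtain ⟨l, -, hl, hlen⟩ := hT.exists_list_length_eq g
  have : l = [] := List.eq_nil_of_length_eq_zero (by omega)
  subst this
  exact hT.one_notMem (by rw [List.prod_nil] at hl; rwa [hl])

theorem exp_neg_le_norm_of_phiPlus_le {T : Finset Γ} (hT : IsSymmGenSet T) {ψ : Γ → ℂ} {β : ℝ}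
    (h : phiPlus T ψ 1 ≤ (β : EReal)) {g : Γ} (hg : g ∈ T) : Real.exp (-β) ≤ ‖ψ g‖ := by
  have h1 : -(β : EReal) ≤ ENNReal.log ‖ψ g‖ₑ :=
    (EReal.neg_le.1 h).trans (iInf₂_le g (hT.wordLength_eq_one hg))
  rcases eq_or_ne (ψ g) 0 with h0 | h0
  · rw [h0, enorm_zero, ENNReal.log_zero, le_bot_iff, ← EReal.coe_neg] at h1
    exact absurd h1 (EReal.coe_ne_bot _)
  · rw [ENNReal.log_pos_real (by simpa using h0) enorm_ne_top, toReal_enorm, ← EReal.coe_neg,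
      EReal.coe_le_coe_iff, Real.le_log_iff_exp_le (norm_pos_iff.2 h0)] at h1
    exact h1

end WordLength

/-! ### Upper bound -/

section UpperBound

open Monoid.CoprodI

/-- There are |X|^n lists of length n. No smallness of q is needed: for ratio at least 1 the
truncated difference is 0 and its inverse is ∞. -/
theorem tsum_list_pow_length_le {X : Type*} [Fintype X] (q : ℝ≥0∞) :
    ∑' l : List X, (if l = [] then 0 else q ^ l.length) =
      (Fintype.card X * q) * (1 - Fintype.card X * q)⁻¹ := by
  classical
  rw [← List.equivSigmaTuple.symm.tsum_eq, ENNReal.tsum_sigma', tsum_eq_zero_add' ENNReal.summable,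
    ← ENNReal.tsum_geometric, ← ENNReal.tsum_mul_left]
  have h0 : ∑' f : Fin 0 → X, (if List.equivSigmaTuple.symm ⟨0, f⟩ = [] then 0 else
      q ^ (List.equivSigmaTuple.symm ⟨0, f⟩).length) = 0 := by
    simp [List.equivSigmaTuple]
  rw [h0, zero_add]
  refine tsum_congr fun n => ?_
  simp [List.equivSigmaTuple, tsum_fintype, mul_pow, pow_succ]
  ring

variable {ι : Type} {Λ : ι → Type u} [∀ i, Group (Λ i)] [Fintype ι]

theorem of_mem_freeProductGen {T : ∀ i, Finset (Λ i)} {i : ι} {g : Λ i} (hg : g ∈ T i) :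
    of g ∈ freeProductGen T := by
  classical
  exact Finset.mem_biUnion.2 ⟨i, Finset.mem_univ i, Finset.mem_image_of_mem _ hg⟩

theorem exists_list_generators_of_hasExpDecay {T : ∀ i, Finset (Λ i)}
    (hT : ∀ i, IsSymmGenSet (T i)) {ψ : ∀ i, Λ i → ℂ} {α : ℝ}
    (hdecay : ∀ i, HasExpDecay (T i) (ψ i) α) (w : Monoid.CoprodI Λ) :
    ∃ l : List (freeProductGen T), (l.map Subtype.val).prod = w ∧
      ‖freeProductFun ψ w‖ ≤ Real.exp (-α * l.length) := by
  obtain ⟨L, hL, rfl⟩ := exists_isReducedList_listEval w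
  rw [freeProductFun_listEval ψ hL]
  -- Concatenation of geodesics works for any list of letters, so reducedness is not carried through
  -- the induction.
  clear hL
  induction L with
  | nil => exact ⟨[], by simp [listEval], by simp [letterProd]⟩
  | cons p L ih =>
    obtain ⟨l, hl, hb⟩ := ih
    obtain ⟨t, ht, hp, hlen⟩ := (hT p.1).exists_list_length_eq p.2
    refine ⟨t.attach.map (fun x => ⟨of x.1, of_mem_freeProductGen (ht x.1 x.2)⟩) ++ l, ?_, ?_⟩
    · have h1 : (t.map fun x => of (i := p.1) x).prod = of p.2 := by
        rw [← hp, map_list_prod]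
      have h2 : List.map (Subtype.val ∘ fun x : {x // x ∈ t} =>
          (⟨of x.1, of_mem_freeProductGen (ht x.1 x.2)⟩ : freeProductGen T)) t.attach =
          t.map fun x => of (i := p.1) x :=
        List.attach_map_val (f := fun x => of (i := p.1) x)
      rw [List.map_append, List.prod_append, hl, List.map_map, h2, h1]
      simp [listEval]
    · have h1 := hdecay p.1 p.2
      rw [← hlen] at h1
      have h2 : letterProd ψ (p :: L) = ψ p.1 p.2 * letterProd ψ L := by simp [letterProd]
      rw [h2, norm_mul]
      refine (mul_le_mul h1 hb (norm_nonneg _) (Real.exp_pos _).le).trans (le_of_eq ?_)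
      rw [← Real.exp_add]
      simp
      ring

theorem ennL2_freeProductFun_pow_sq_le {T : ∀ i, Finset (Λ i)}
    (hT : ∀ i, IsSymmGenSet (T i)) {ψ : ∀ i, Λ i → ℂ} {α : ℝ}
    (hdecay : ∀ i, HasExpDecay (T i) (ψ i) α) (m : ℕ) {ρ : ℝ}
    (hρ : (freeProductGen T).card * Real.exp (-2 * α * m) ≤ ρ)
    (h1 : freeProductFun ψ (1 : Monoid.CoprodI Λ) = 1) :
    ennL2 (fun w => ‖freeProductFun ψ w ^ m - canonicalTrace (Monoid.CoprodI Λ) w‖ₑ) ^ 2 ≤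
      ENNReal.ofReal ρ * (1 - ENNReal.ofReal ρ)⁻¹ := by
  classical
  choose l hl hb using exists_list_generators_of_hasExpDecay hT hdecay
  -- A word is the product of its chosen list, so a sum over words is at most a sum over all lists.
  have hinj : Function.Injective l := fun v w h => by rw [← hl v, ← hl w, h]
  set q := ENNReal.ofReal (Real.exp (-2 * α * m)) with hq
  have hpt : ∀ w, ‖freeProductFun ψ w ^ m - canonicalTrace (Monoid.CoprodI Λ) w‖ₑ ^ 2 ≤
      if l w = [] then 0 else q ^ (l w).length := by
    intro w
    by_cases hw : w = 1
    · subst hw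
      simp [canonicalTrace, h1]
    · have hne : l w ≠ [] := fun h => hw (by rw [← hl w, h]; rfl)
      rw [if_neg hne, canonicalTrace, if_neg hw, sub_zero, ← ofReal_norm, hq,
        ← ENNReal.ofReal_pow (norm_nonneg _), ← ENNReal.ofReal_pow (Real.exp_pos _).le]
      refine ENNReal.ofReal_le_ofReal ?_
      rw [norm_pow, ← pow_mul]
      refine (pow_le_pow_left₀ (norm_nonneg _) (hb w) _).trans (le_of_eq ?_)
      rw [← Real.exp_nat_mul, ← Real.exp_nat_mul]
      congr 1
      push_cast
      ring
  have hR : (Fintype.card (freeProductGen T) : ℝ≥0∞) * q ≤ ENNReal.ofReal ρ := by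
    rw [Fintype.card_coe, hq, ← ENNReal.ofReal_natCast, ← ENNReal.ofReal_mul (Nat.cast_nonneg _)]
    exact ENNReal.ofReal_le_ofReal hρ
  rw [ennL2_sq]
  calc _ ≤ ∑' w, (fun t : List (freeProductGen T) => if t = [] then 0 else q ^ t.length) (l w) :=
        ENNReal.tsum_le_tsum hpt
    _ ≤ ∑' t : List (freeProductGen T), (if t = [] then 0 else q ^ t.length) :=
        ENNReal.tsum_comp_le_tsum_of_injective hinj _
    _ = _ := tsum_list_pow_length_le q
    _ ≤ _ := mul_le_mul' hR (ENNReal.inv_le_inv.2 (tsub_le_tsub_left hR 1))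

theorem memlp_two_of_ennL2_ne_top {X : Type*} {f : X → ℂ} (h : ennL2 (fun x => ‖f x‖ₑ) ^ 2 ≠ ∞) :
    Memℓp f 2 := by
  rw [ennL2_sq] at h
  rw [memℓp_gen_iff (by norm_num)]
  simpa using ENNReal.summable_toReal h

theorem card_mul_exp_le {n : ℕ} {α c m : ℝ} (hα : 0 < α)
    (h : Real.log (Real.sqrt n) / α + c ≤ m) :
    n * Real.exp (-2 * α * m) ≤ Real.exp (-2 * α * c) := by
  -- For n = 0 the logarithm takes its default value 0, and the left side vanishes.
  rcases Nat.eq_zero_or_pos n with rfl | hn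
  · simp [Real.exp_nonneg]
  · have hn' : (0 : ℝ) < n := by exact_mod_cast hn
    have h1 : (n : ℝ) = Real.exp (2 * Real.log (Real.sqrt n)) := by
      rw [Real.log_sqrt hn'.le, mul_div_cancel₀ _ (two_ne_zero), Real.exp_log hn']
    nth_rewrite 1 [h1]
    rw [← Real.exp_add, Real.exp_le_exp]
    have h2 := mul_le_mul_of_nonneg_left h hα.le
    rw [mul_add, mul_div_cancel₀ _ hα.ne'] at h2
    linarith

theorem tvNorm_freeProductFun_pow_le {T : ∀ i, Finset (Λ i)}
    (hT : ∀ i, IsSymmGenSet (T i)) {ψ : ∀ i, Λ i → ℂ} (hψ : ∀ i, IsState (ψ i)) {α : ℝ}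
    (hα : 0 < α) (hdecay : ∀ i, HasExpDecay (T i) (ψ i) α) {c : ℝ} (hc : 0 < c) (m : ℕ)
    (hm : Real.log (Real.sqrt ((freeProductGen T).card : ℝ)) / α + c ≤ m) :
    tvNorm (fun w => freeProductFun ψ w ^ m - canonicalTrace (Monoid.CoprodI Λ) w) ≤
      ENNReal.ofReal (2 * Real.exp (-α * c)) := by
  have hst := isState_freeProductFun hψ
  have hbound := ennL2_freeProductFun_pow_sq_le hT hdecay m (card_mul_exp_le hα hm) hst.map_one
  set ρ := Real.exp (-2 * α * c) with hρ
  have hρ1 : ρ < 1 := by rw [hρ, Real.exp_lt_one_iff]; nlinarith [mul_pos hα hc]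
  have hρ2 : Real.exp (-α * c) ^ 2 = ρ := by
    rw [hρ, ← Real.exp_nat_mul]; congr 1; push_cast; ring
  have hρ0 : 0 < ρ := Real.exp_pos _
  have hinv : (1 - ENNReal.ofReal ρ)⁻¹ = ENNReal.ofReal (1 - ρ)⁻¹ := by
    rw [← ENNReal.ofReal_one, ← ENNReal.ofReal_sub _ hρ0.le,
      ENNReal.ofReal_inv_of_pos (by linarith)]
  rw [hinv, ← ENNReal.ofReal_mul hρ0.le] at hbound
  have hmem := memlp_two_of_ennL2_ne_top (ne_top_of_le_ne_top ENNReal.ofReal_ne_top hbound)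
  have hx : 0 < Real.exp (-α * c) := Real.exp_pos _
  -- For ρ ≤ 1/2 the geometric series is at most 2ρ. For ρ > 1/2 the target 2√ρ exceeds 1, and the
  -- bound for states suffices.
  rcases le_or_gt ρ (1 / 2) with h | h
  · refine (tvNorm_le_of_memlp hmem).trans ?_
    have h3 : ‖(⟨_, hmem⟩ : ℓ²(Monoid.CoprodI Λ, ℂ))‖ₑ ≤ ENNReal.ofReal (2 * Real.exp (-α * c)) := by
      rw [enorm_lp_two, ← ENNReal.pow_le_pow_left_iff (n := 2) (by norm_num)]
      refine hbound.trans ?_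
      rw [← ENNReal.ofReal_pow (by positivity)]
      refine ENNReal.ofReal_le_ofReal ?_
      rw [mul_pow, hρ2]
      have : (1 - ρ)⁻¹ ≤ 2 := by
        rw [inv_le_comm₀ (by linarith) (by norm_num)]; linarith
      nlinarith
    refine (mul_le_mul_right h3 _).trans (mul_le_of_le_one_left' ?_)
    norm_num
  · have hd : Memℓp (canonicalTrace (Monoid.CoprodI Λ)) 2 := by
      rw [← coe_deltaVec]; exact lp.memℓp _
    have hφ : Memℓp (fun w => freeProductFun ψ w ^ m) 2 := by
      convert hmem.add hd using 1
      ext w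
      simp
    refine (tvNorm_sub_canonicalTrace_le_one (hst.pow m) hφ).trans ?_
    rw [← ENNReal.ofReal_one]
    refine ENNReal.ofReal_le_ofReal ?_
    nlinarith

end UpperBound

/-! ### Lower bound -/

section LowerBound

theorem le_tvNorm_of_finset {Γ : Type u} [Group Γ] {f : Γ → ℂ} (S : Finset Γ) {K t : ℝ}
    (hK : ∀ c : Γ → ℂ, (∀ g, ‖c g‖ ≤ 1) → ‖∑ s ∈ S, c s • leftReg s‖ ≤ K)
    (hK0 : 0 < K) (hf : 2 * t * K ≤ ∑ s ∈ S, ‖f s‖) : ENNReal.ofReal t ≤ tvNorm f := by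
  have h1 : ENNReal.ofReal t = 2⁻¹ * ENNReal.ofReal (2 * t) := by
    rw [ENNReal.ofReal_mul (by norm_num), ENNReal.ofReal_ofNat, ← mul_assoc,
      ENNReal.inv_mul_cancel (by norm_num) (by norm_num), one_mul]
  rw [h1, tvNorm]
  refine mul_le_mul_right (le_iInf₂ fun F hF => ?_) _
  rw [← ofReal_norm]
  refine ENNReal.ofReal_le_ofReal ?_
  -- The phase that makes c_g f(g) = |f(g)|; division by zero gives 0 where f vanishes.
  let c : Γ → ℂ := fun g => (starRingEnd ℂ) (f g) / ‖f g‖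
  have hc : ∀ g, ‖c g‖ ≤ 1 := fun g => by
    simp only [c, norm_div, RCLike.norm_conj, Complex.norm_real, norm_norm]
    exact div_self_le_one _
  have hcf : ∀ g, c g * f g = (‖f g‖ : ℂ) := fun g => by
    rcases eq_or_ne (f g) 0 with h | h
    · simp [c, h]
    · have : (‖f g‖ : ℂ) ≠ 0 := by simpa using h
      simp only [c]
      rw [div_mul_eq_mul_div, Complex.conj_mul', sq, mul_div_cancel_right₀ _ this]
  have hFx : F (∑ s ∈ S, c s • groupVN.of s) = ((∑ s ∈ S, ‖f s‖ : ℝ) : ℂ) := by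
    rw [map_sum]
    push_cast
    refine Finset.sum_congr rfl fun s _ => ?_
    rw [map_smul, hF.2, smul_eq_mul, hcf]
  have hx : ‖(∑ s ∈ S, c s • groupVN.of s : (groupVN Γ).toStarSubalgebra)‖ ≤ K := by
    refine le_trans (le_of_eq ?_) (hK c hc)
    have : ((∑ s ∈ S, c s • groupVN.of s : (groupVN Γ).toStarSubalgebra) :
        ℓ²(Γ, ℂ) →L[ℂ] ℓ²(Γ, ℂ)) = ∑ s ∈ S, c s • leftReg s := by
      rw [AddSubmonoidClass.coe_finsetSum]
      rfl
    rw [← this]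
    rfl
  have h2 := F.le_opNorm (∑ s ∈ S, c s • groupVN.of s)
  rw [hFx, Complex.norm_real, Real.norm_of_nonneg (Finset.sum_nonneg fun _ _ => norm_nonneg _)] at h2
  have h3 := hf.trans (h2.trans (mul_le_mul_of_nonneg_left hx (norm_nonneg F)))
  exact le_of_mul_le_mul_right h3 hK0

open Monoid.CoprodI

variable {ι : Type} {Λ : ι → Type u} [∀ i, Group (Λ i)]

theorem freeProductFun_of (ψ : ∀ i, Λ i → ℂ) {i : ι} {g : Λ i} (hg : g ≠ 1) :
    freeProductFun ψ (of g) = ψ i g := by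
  have := freeProductFun_listEval ψ (l := [⟨i, g⟩]) ⟨by simpa using hg, List.isChain_singleton _⟩
  simpa [listEval, letterProd] using this

variable [Fintype ι]

theorem le_tvNorm_freeProductFun_pow {T : ∀ i, Finset (Λ i)}
    (hT : ∀ i, IsSymmGenSet (T i)) {ψ : ∀ i, Λ i → ℂ} {β δ : ℝ}
    (hβ : 0 < β) (hδ : 0 < δ)
    (hnorm : ∀ i, ‖∑ g ∈ T i, leftReg g‖ ≤ δ * Real.sqrt ((T i).card : ℝ))
    (hplus : ∀ i, phiPlus (T i) (ψ i) 1 ≤ (β : EReal)) {c : ℝ} (hc : 0 < c) (m : ℕ)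
    (hm : (m : ℝ) ≤ Real.log (Real.sqrt ((freeProductGen T).card : ℝ)) / β - c) :
    ENNReal.ofReal (1 - 2 * (δ + 2) * Real.exp (-β * c)) ≤
      tvNorm (fun w => freeProductFun ψ w ^ m - canonicalTrace (Monoid.CoprodI Λ) w) := by
  classical
  set n := (freeProductGen T).card with hn
  -- With no generators the logarithm is 0 by default, and m ≤ -c is impossible.
  have hn0 : 0 < n := by
    rcases Nat.eq_zero_or_pos n with h | h
    · rw [h] at hm
      simp at hm
      have := Nat.cast_nonneg (α := ℝ) m
      linarith
    · exact h
  have hn' : (0 : ℝ) < n := by exact_mod_cast hn0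
  have hsq : 0 < Real.sqrt n := Real.sqrt_pos.2 hn'
  -- The ratio of |S| exp(-βm) to 2(δ + 2)√|S| is at least t. This is stronger than the claimed 1 −
  -- t⁻¹, since t + t⁻¹ ≥ 1.
  set t := Real.exp (β * c) / (2 * (δ + 2)) with ht
  have ht0 : 0 < t := by positivity
  have h1 : 1 - 2 * (δ + 2) * Real.exp (-β * c) ≤ t := by
    have h2 : 2 * (δ + 2) * Real.exp (-β * c) = t⁻¹ := by
      rw [ht, inv_div, neg_mul, Real.exp_neg]
      rfl
    rw [h2]
    have h3 : t * t⁻¹ = 1 := mul_inv_cancel₀ ht0.ne'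
    have h4 : 0 < t⁻¹ := inv_pos.2 ht0
    nlinarith [sq_nonneg (t - t⁻¹)]
  refine (ENNReal.ofReal_le_ofReal h1).trans ?_
  refine le_tvNorm_of_finset (freeProductGen T) (K := (δ + 2) * Real.sqrt n)
    (norm_sum_smul_leftReg_freeProductGen_le T hT hδ hnorm) (by positivity) ?_
  have hterm : ∀ s ∈ freeProductGen T, Real.exp (-β * m) ≤
      ‖freeProductFun ψ s ^ m - canonicalTrace (Monoid.CoprodI Λ) s‖ := by
    intro s hs
    obtain ⟨i, -, hi⟩ := Finset.mem_biUnion.1 hs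
    obtain ⟨g, hg, rfl⟩ := Finset.mem_image.1 hi
    have hg1 : g ≠ 1 := fun h => (hT i).one_notMem (h ▸ hg)
    have hg2 : of g ≠ (1 : Monoid.CoprodI Λ) := fun h => hg1 (of_injective i (by rw [h, map_one]))
    rw [canonicalTrace, if_neg hg2, sub_zero, freeProductFun_of ψ hg1, norm_pow, mul_comm,
      Real.exp_nat_mul]
    exact pow_le_pow_left₀ (Real.exp_pos _).le (exp_neg_le_norm_of_phiPlus_le (hT i) (hplus i) hg) m
  have hsum := Finset.card_nsmul_le_sum _ _ _ hterm
  refine le_trans ?_ hsum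
  have hm2 : β * m ≤ Real.log (Real.sqrt n) - β * c := by
    have := mul_le_mul_of_nonneg_left hm hβ.le
    rwa [mul_sub, mul_div_cancel₀ _ hβ.ne'] at this
  have h5 : Real.exp (β * c) ≤ Real.sqrt n * Real.exp (-β * m) := by
    nth_rewrite 1 [← Real.exp_log hsq]
    rw [← Real.exp_add, Real.exp_le_exp]
    linarith
  have h6 : 2 * t * ((δ + 2) * Real.sqrt n) = Real.exp (β * c) * Real.sqrt n := by
    rw [ht]; field_simp
  rw [h6, nsmul_eq_mul, ← hn]
  calc Real.exp (β * c) * Real.sqrt n ≤ (Real.sqrt n * Real.exp (-β * m)) * Real.sqrt n :=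
        mul_le_mul_of_nonneg_right h5 hsq.le
    _ = (Real.sqrt n * Real.sqrt n) * Real.exp (-β * m) := by ring
    _ = _ := by rw [Real.mul_self_sqrt hn'.le]

end LowerBound
end

/-! ### The pre-cut-off for free products -/

theorem mainTheorem2
    (Λ : ℕ → Type u) [∀ i, Group (Λ i)]
    (T : ∀ i, Finset (Λ i)) (hT : ∀ i, IsSymmGenSet (T i))
    (ψ : ∀ i, Λ i → ℂ) (hψ : ∀ i, IsState (ψ i))
    (α β δ : ℝ) (hα : 0 < α) (hβ : 0 < β) (hδ : 0 < δ)
    (hdecay : ∀ i, HasExpDecay (T i) (ψ i) α)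
    (hnorm : ∀ i, ‖∑ g ∈ T i, leftReg g‖ ≤ δ * Real.sqrt ((T i).card : ℝ))
    (hplus : ∀ i, phiPlus (T i) (ψ i) 1 ≤ (β : EReal)) :
    (∀ N : ℕ, IsState (freeProductFun (fun i : Fin N => ψ i))) ∧
    HasPreCutOff
      (Γ := fun N => Monoid.CoprodI (fun i : Fin N => Λ i))
      (fun N => freeProductFun (fun i : Fin N => ψ i))
      (fun N => Real.log (Real.sqrt ((freeProductGen (fun i : Fin N => T i)).card : ℝ)) / β)
      (fun N => Real.log (Real.sqrt ((freeProductGen (fun i : Fin N => T i)).card : ℝ)) / α) := by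
  -- The constants B = 2, B' = 2(δ + 2), λ = α, λ' = β do not depend on N, and both estimates hold
  -- for every N, not only for large ones.
  refine ⟨fun N => isState_freeProductFun fun i : Fin N => hψ i, 2, 2 * (δ + 2), α, β, by norm_num,
    by positivity, hα, hβ, fun c hc => Filter.Eventually.of_forall fun N => ⟨fun m hm => ?_,
    fun m hm => ?_⟩⟩
  · exact le_tvNorm_freeProductFun_pow (fun i : Fin N => hT i) hβ hδ (fun i => hnorm i)
      (fun i => hplus i) hc m hm
  · exact tvNorm_freeProductFun_pow_le (fun i : Fin N => hT i) (fun i => hψ i) hα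
      (fun i => hdecay i) hc m hm
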